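/- Fix a base-station (BS) density $\lambda>0$, a path-loss exponent $\beta>2$, a radar cross section $\sigma\neq 0$, a sensing power $p^s>0$ and a total power $p^t>0$ per BS, numbers $M_t\ge 2$ and $M_r\ge 1$ of transmit and receive antennas. Let the BS positions $\mathbf d_1,\mathbf d_2,\dots$, listed in order of increasing distance from the origin, form a homogeneous Poisson point process of intensity $\lambda$ in $\mathbb R^2$; the sensing target is at the origin. Let $f_1\sim\Gamma(M_t-1,1)$ and $f_q\sim\exp(1)$, $q\ge 2$, be the small-scale fading parameters, mutually independent and independent of the BS positions. In non-cooperative sensing ($N=1$) the nearest BS senses the target and all the other BSs interfere, so that no interfering BS lies within distance $r_1=\|\mathbf d_1\|$ of the target (the interference hole). The sensing signal-to-interference ratio and the radar information rate are $$\mathrm{SIR}_s=\sigma^2M_r\,\frac{\|\mathbf d_1\|^{-\beta}\,p^sf_1\|\mathbf d_1\|^{-\beta}}{\sum_{q\ge2}p^tf_q\|\mathbf d_1-\mathbf d_q\|^{-\beta}},\qquad R_s=\mathbb E[\log(1+\mathrm{SIR}_s)],$$ with the natural logarithm. Then the interference sum in the denominator converges and is positive almost surely, $\log(1+\mathrm{SIR}_s)$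 is integrable, the integrals below converge absolutely, and $$\begin{aligned}R_s=\int_0^\infty&\frac1z\left(1-\frac1{(1+z\sigma^2M_rp^s)^{M_t-1}}\right)\int_0^\infty f(r_1)\exp\left(-\pi\lambda r_1^4\,\frac2\beta\,(zp^t)^{2/\beta}\,B\left(\frac2\beta,1-\frac2\beta\right)\right)\\&\times\exp\left(\lambda r_1^2\int_0^2 2\arccos\left(\frac t2\right)\frac{zp^tr_1^\beta t^{-\beta}}{1+zp^tr_1^\beta t^{-\beta}}\,t\,dt\right)dr_1\,dz,\end{aligned}$$ where $f(r_1)=2\pi\lambda r_1e^{-\pi\lambda r_1^2}$ is the probability density of $r_1=\|\mathbf d_1\|$ and $B(a,b)=\int_0^1t^{a-1}(1-t)^{b-1}\,dt$. -/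

import Mathlib

open MeasureTheory ProbabilityTheory Set
open scoped NNReal ENNReal

namespace CoopSensing

/-- The Euclidean plane. -/
abbrev Plane : Type := EuclideanSpace ℝ (Fin 2)

section
variable {Ω : Type*}

/-- Number of points of the configuration `d 0 ω, d 1 ω, …` (with multiplicity) lying in `B`. -/
noncomputable def pointCount (d : ℕ → Ω → Plane) (B : Set Plane) (ω : Ω) : ℕ∞ :=
  {i : ℕ | d i ω ∈ B}.encard

variable [MeasurableSpace Ω]

/-- The random points `d 0, d 1, …` form a homogeneous Poisson point process of intensity `lam`
on the plane: counts in Borel sets of finite area are Poisson with mean `lam * area`, and counts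
in pairwise disjoint such sets are independent. -/
structure IsHomogeneousPPP (μ : Measure Ω) (lam : ℝ≥0) (d : ℕ → Ω → Plane) : Prop where
  measurable_point : ∀ i, Measurable (d i)
  count_law : ∀ B : Set Plane, MeasurableSet B → volume B ≠ ∞ →
    μ.map (pointCount d B) =
      (poissonMeasure (lam * (volume B).toNNReal)).map (fun n : ℕ => (n : ℕ∞))
  count_indep : ∀ (n : ℕ) (B : Fin n → Set Plane),
    (∀ j, MeasurableSet (B j)) → (∀ j, volume (B j) ≠ ∞) →
    Pairwise (fun j k => Disjoint (B j) (B k)) →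
    iIndepFun (fun j => pointCount d (B j)) μ

/-- The random network seen from the typical target, which sits at the origin.
`d i` is the position of the `(i+1)`-th nearest base station to the target, the base stations
forming a homogeneous Poisson point process. The first `N` base stations sense the target, all
others interfere. The small-scale fading parameters `f i` are mutually independent and independent
of the positions; they have the law `Γ(Mt - 1, 1)` for sensing base stations
and `exp(1)` for interfering ones. -/
structure IsSensingNetwork (μ : Measure Ω) (lam : ℝ≥0) (Mt N : ℕ)
    (d : ℕ → Ω → Plane) (f : ℕ → Ω → ℝ) : Prop where
  ppp : IsHomogeneousPPP μ lam d
  sorted : ∀ᵐ ω ∂μ, Monotone (fun i => ‖d i ω‖)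
  measurable_fading : ∀ i, Measurable (f i)
  law_sensing : ∀ i, i < N → μ.map (f i) = gammaMeasure ((Mt : ℝ) - 1) 1
  law_interfering : ∀ i, N ≤ i → μ.map (f i) = expMeasure 1
  indep_fading : iIndepFun f μ
  indep_positions : IndepFun (fun ω i => d i ω) (fun ω i => f i ω) μ

end

section
variable {Ω : Type*}

/-- Power received at base station 1 from the `k`-th interfering base station, that is, from base
station number `N + k` in the zero-based order. -/
noncomputable def interferenceTerm (β pt : ℝ) (N : ℕ) (d : ℕ → Ω → Plane) (f : ℕ → Ω → ℝ)
    (k : ℕ) (ω : Ω) : ℝ :=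
  pt * f (N + k) ω * ‖d 0 ω - d (N + k) ω‖ ^ (-β)

/-- Total interference power at base station 1. -/
noncomputable def interference (β pt : ℝ) (N : ℕ) (d : ℕ → Ω → Plane) (f : ℕ → Ω → ℝ)
    (ω : Ω) : ℝ :=
  ∑' k : ℕ, interferenceTerm β pt N d f k ω

/-- Sensing signal-to-interference ratio at base station 1, with `N` sensing base stations,
`Mr` receive antennas, radar cross section `σ`, path-loss exponent `β`, sensing power `ps` and
total power `pt`. -/
noncomputable def sensingSIR (β σ ps pt : ℝ) (Mr N : ℕ) (d : ℕ → Ω → Plane) (f : ℕ → Ω → ℝ)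
    (ω : Ω) : ℝ :=
  σ ^ 2 * Mr *
    (‖d 0 ω‖ ^ (-β) * ∑ i ∈ Finset.range N, ps * f i ω * ‖d i ω‖ ^ (-β)) /
    interference β pt N d f ω

/-- Radar information rate `E[log (1 + SIR)]`, with the natural logarithm. -/
noncomputable def radarInformationRate [MeasurableSpace Ω] (μ : Measure Ω) (β σ ps pt : ℝ)
    (Mr N : ℕ) (d : ℕ → Ω → Plane) (f : ℕ → Ω → ℝ) : ℝ :=
  ∫ ω, Real.log (1 + sensingSIR β σ ps pt Mr N d f ω) ∂μ

end

/-- The Beta function `B(a, b) = ∫₀¹ t ^ (a - 1) (1 - t) ^ (b - 1) dt`. -/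
noncomputable def betaFn (a b : ℝ) : ℝ :=
  ∫ t in (0 : ℝ)..1, t ^ (a - 1) * (1 - t) ^ (b - 1)

/-- Density of the distance from the target to the nearest base station. -/
noncomputable def nearestDensity (lam r : ℝ) : ℝ :=
  2 * Real.pi * lam * r * Real.exp (-(Real.pi * lam * r ^ 2))

/-- The factor due to interferers spread over the whole plane. -/
noncomputable def fullPlaneFactor (lam β pt z r : ℝ) : ℝ :=
  Real.exp (-(Real.pi * lam * r ^ 4 * (2 / β) * (z * pt) ^ (2 / β) * betaFn (2 / β) (1 - 2 / β)))

/-- The factor correcting for the absence of interferers in the disk of radius `r`. -/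
noncomputable def holeFactor (lam β pt z r : ℝ) : ℝ :=
  Real.exp (lam * r ^ 2 * ∫ t in (0 : ℝ)..2,
    2 * Real.arccos (t / 2) *
      (z * pt * r ^ β * t ^ (-β) / (1 + z * pt * r ^ β * t ^ (-β))) * t)

/-- Integrand of the middle integral (over the distance `r`). -/
noncomputable def distanceIntegrand (lam β pt z r : ℝ) : ℝ :=
  nearestDensity lam r * (fullPlaneFactor lam β pt z r * holeFactor lam β pt z r)

/-- Integrand of the outer integral (over `z`). -/
noncomputable def rateIntegrand (lam β σ ps pt : ℝ) (Mt Mr : ℕ) (z : ℝ) : ℝ :=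
  1 / z * (1 - 1 / (1 + z * σ ^ 2 * Mr * ps) ^ (Mt - 1)) *
    ∫ r in Ioi (0 : ℝ), distanceIntegrand lam β pt z r

end CoopSensing

/-! ### Poisson generating functions and products over the points of a configuration. -/

namespace CoopSensing
open Filter Topology Metric

/-! Let x be the position of the nearest base station and r = |x|. After cancelling path losses the
SIR is X/Y, where X = σ² M_r p^s f₁ and Y is r^{2β} times the interference. For X ≥ 0 and Y > 0,
Frullani's integral gives log(1 + X/Y) = ∫₀^∞ z⁻¹ (1 - e^{-zX}) e^{-zY} dz. Since X and Y are
independent, Tonelli (`integrable_log_one_add_div`) leaves only two Laplace transforms to compute: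
that of a Gamma variable, which gives the factor with M_t - 1, and that of Y.

Given the positions, integrating out the exponential fading turns e^{-zY} into the product of 1/(1 +
z p^t r^{2β} |x - y|^{-β}) over the interferers y (`integral_mul_prod_exp_fading`). The nearest
point has density λ e^{-πλ|x|²} in the plane, and beyond it the process is again Poisson, so the
mean of such a product is ∫ λ e^{-πλ|x|²} exp(-λ ∫_{|y|>|x|} (1 - g(x, y)) dy) dx
(`IsHomogeneousPPP.integral_nearest`). Only the joint law of counts in disjoint sets is given, so
this is obtained from counts: simple functions first, then the nearest point confined to a small
cell, then refinement of the cells, then removal of a cutoff radius K.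

The exponent over |y| > r is the whole-plane integral minus the integral over the hole
(`outsideExponent_eq`). In polar coordinates around x the first becomes a Beta integral; in the
second, the circle of radius ρ around x meets the disk |y| ≤ r in an arc of angle 2 arccos(ρ/(2r)).

Convergence comes from the same formula. The Laplace transform tends to 1 as z → 0, which forces Y
to be finite almost surely. The hole accounts for at most half of the whole-plane exponent, so the
transform is O(z^{-1/β}) and the outer integral converges at infinity. -/

theorem integral_pow_poissonMeasure (r : ℝ≥0) (v : ℝ) :
    ∫ n, v ^ n ∂poissonMeasure r = Real.exp (-(r * (1 - v))) := by
  rw [integral_poissonMeasure]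
  have h := ((NormedSpace.expSeries_div_hasSum_exp ((r : ℝ) * v)).mul_left
    (Real.exp (-r))).tsum_eq
  rw [← Real.exp_eq_exp_ℝ, ← Real.exp_add] at h
  rw [show -((r : ℝ) * (1 - v)) = -r + r * v by ring, ← h]
  refine tsum_congr fun n => ?_
  rw [smul_eq_mul, mul_pow]
  ring

theorem integral_indicator_one_poissonMeasure (r : ℝ≥0) :
    ∫ n, (if n = 1 then (1 : ℝ) else 0) ∂poissonMeasure r = r * Real.exp (-r) := by
  rw [integral_poissonMeasure, tsum_eq_single 1]
  · simp [mul_comm]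
  · intro n hn
    simp [hn]

/-- The product of `g` over the points of the configuration lying in `B`. -/
noncomputable def pointProd {Ω : Type*} (d : ℕ → Ω → Plane) (B : Set Plane) (g : Plane → ℝ)
    (ω : Ω) : ℝ :=
  ∏ᶠ j ∈ {j : ℕ | d j ω ∈ B}, g (d j ω)

section
variable {Ω : Type*} {d : ℕ → Ω → Plane} {B : Set Plane} {ω : Ω}

theorem pointProd_eq_prod (hB : {j : ℕ | d j ω ∈ B}.Finite) (g : Plane → ℝ) :
    pointProd d B g ω = ∏ j ∈ hB.toFinset, g (d j ω) :=
  finprod_mem_eq_finite_toFinset_prod _ hB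

theorem abs_pointProd_le_one (hB : {j : ℕ | d j ω ∈ B}.Finite) {g : Plane → ℝ}
    (hg : ∀ x, |g x| ≤ 1) : |pointProd d B g ω| ≤ 1 := by
  rw [pointProd_eq_prod hB, Finset.abs_prod]
  exact Finset.prod_le_one (fun _ _ => abs_nonneg _) fun _ _ => hg _

theorem tendsto_pointProd {B : Set Plane} {ω : Ω} (hω : {j : ℕ | d j ω ∈ B}.Finite)
    {G : ℕ → Plane → ℝ} {g : Plane → ℝ} (hG : ∀ x, Tendsto (fun n => G n x) atTop (𝓝 (g x))) :
    Tendsto (fun n => pointProd d B (G n) ω) atTop (𝓝 (pointProd d B g ω)) := by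
  simp_rw [pointProd_eq_prod hω]
  exact tendsto_finsetProd _ fun j _ => hG _

/-- Grouping the points by the value of `g` reduces the product to finitely many counts in disjoint
cells, the only quantities whose joint law is known. -/
theorem pointProd_simpleFunc [MeasurableSpace Plane] (hB : {j : ℕ | d j ω ∈ B}.Finite)
    (g : SimpleFunc Plane ℝ) :
    pointProd d B g ω = ∏ v ∈ g.range, v ^ (pointCount d (B ∩ g ⁻¹' {v}) ω).toNat := by
  classical
  rw [pointProd_eq_prod hB,
    ← Finset.prod_fiberwise_of_maps_to (t := g.range) (g := fun j => g (d j ω))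
      (fun j _ => g.mem_range_self _)]
  refine Finset.prod_congr rfl fun v _ => ?_
  rw [Finset.prod_congr rfl (g := fun _ => v) (fun j hj => (Finset.mem_filter.1 hj).2),
    Finset.prod_const]
  congr 1
  have : {i : ℕ | d i ω ∈ B ∩ g ⁻¹' {v}} =
      ((hB.toFinset.filter fun j => g (d j ω) = v : Finset ℕ) : Set ℕ) := by
    ext j; simp
  rw [pointCount, this, Set.encard_coe_eq_coe_finsetCard]
  rfl

end

/-! ### Generating functional of the point process on sets of finite area. -/

namespace IsHomogeneousPPP
variable {Ω : Type*} [MeasurableSpace Ω] {μ : Measure Ω} {lam : ℝ≥0}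
  {d : ℕ → Ω → Plane}

/-- The image measure under a map that is not a.e. measurable is 0 by convention, whereas
`count_law` makes it a probability measure. -/
theorem aemeasurable_pointCount (h : IsHomogeneousPPP μ lam d) {B : Set Plane}
    (hB : MeasurableSet B) (hvB : volume B ≠ ∞) : AEMeasurable (pointCount d B) μ := by
  refine aemeasurable_of_map_neZero ⟨?_⟩
  rw [h.count_law B hB hvB]
  have : IsProbabilityMeasure ((poissonMeasure (lam * (volume B).toNNReal)).map
      (fun n : ℕ => (n : ℕ∞))) := Measure.isProbabilityMeasure_map .of_discrete
  exact IsProbabilityMeasure.ne_zero _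

theorem iIndepFun_pointCount (h : IsHomogeneousPPP μ lam d) {ι : Type*} [Fintype ι]
    (B : ι → Set Plane) (hB : ∀ i, MeasurableSet (B i)) (hvB : ∀ i, volume (B i) ≠ ∞)
    (hd : Pairwise fun i j => Disjoint (B i) (B j)) :
    iIndepFun (fun i => pointCount d (B i)) μ := by
  let e := Fintype.equivFin ι
  have := (h.count_indep _ (fun i => B (e.symm i)) (fun i => hB _) (fun i => hvB _)
    (fun i j hij => hd (e.symm.injective.ne hij))).precomp e.injective
  simpa using this

theorem integral_comp_pointCount (h : IsHomogeneousPPP μ lam d) {B : Set Plane}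
    (hB : MeasurableSet B) (hvB : volume B ≠ ∞) (φ : ℕ∞ → ℝ) :
    ∫ ω, φ (pointCount d B ω) ∂μ =
      ∫ n : ℕ, φ n ∂poissonMeasure (lam * (volume B).toNNReal) := by
  rw [← integral_map (h.aemeasurable_pointCount hB hvB)
    (Measurable.of_discrete.aestronglyMeasurable), h.count_law B hB hvB,
    integral_map .of_discrete (Measurable.of_discrete.aestronglyMeasurable)]

theorem ae_finite (h : IsHomogeneousPPP μ lam d) {B : Set Plane}
    (hB : MeasurableSet B) (hvB : volume B ≠ ∞) : ∀ᵐ ω ∂μ, {j : ℕ | d j ω ∈ B}.Finite := by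
  have h1 : ∀ᵐ n ∂(μ.map (pointCount d B)), n ≠ ⊤ := by
    rw [h.count_law B hB hvB, ae_map_iff .of_discrete .of_discrete]
    simp
  filter_upwards [ae_of_ae_map (h.aemeasurable_pointCount hB hvB) h1] with ω hω
  exact Set.encard_ne_top_iff.1 hω

theorem ae_notMem_of_volume_eq_zero (h : IsHomogeneousPPP μ lam d) {B : Set Plane}
    (hB : MeasurableSet B) (hvB : volume B = 0) : ∀ᵐ ω ∂μ, ∀ j, d j ω ∉ B := by
  have hvB' : volume B ≠ ∞ := by simp [hvB]
  have h1 : ∀ᵐ n ∂(μ.map (pointCount d B)), n = 0 := by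
    rw [h.count_law B hB hvB', ae_map_iff .of_discrete .of_discrete, hvB, ae_iff]
    have : {a : ℕ | ¬((a : ℕ∞) = 0)} = {0}ᶜ := by ext; simp
    rw [this, prob_compl_eq_zero_iff (measurableSet_singleton _), poissonMeasure_singleton]
    simp
  filter_upwards [ae_of_ae_map (h.aemeasurable_pointCount hB hvB') h1] with ω hω j hj
  have : {i : ℕ | d i ω ∈ B} = ∅ := Set.encard_eq_zero.1 hω
  exact this.subset hj

theorem aemeasurable_pointProd_simpleFunc (h : IsHomogeneousPPP μ lam d)
    {B : Set Plane} (hB : MeasurableSet B) (hvB : volume B ≠ ∞) (g : SimpleFunc Plane ℝ) :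
    AEMeasurable (pointProd d B g) μ := by
  have h1 : AEMeasurable
      (fun ω => ∏ v ∈ g.range, v ^ (pointCount d (B ∩ g ⁻¹' {v}) ω).toNat) μ := by
    refine Finset.aemeasurable_fun_prod _ fun v _ => ?_
    exact (Measurable.of_discrete (f := fun n : ℕ∞ => v ^ n.toNat)).comp_aemeasurable
      (h.aemeasurable_pointCount (hB.inter (g.measurableSet_preimage _))
        ((measure_mono inter_subset_left).trans_lt hvB.lt_top).ne)
  refine h1.congr ?_
  filter_upwards [h.ae_finite hB hvB] with ω hω
  exact (pointProd_simpleFunc hω g).symm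

theorem aemeasurable_pointProd (h : IsHomogeneousPPP μ lam d)
    {B : Set Plane} (hB : MeasurableSet B) (hvB : volume B ≠ ∞) {g : Plane → ℝ}
    (hg : Measurable g) : AEMeasurable (pointProd d B g) μ := by
  refine aemeasurable_of_tendsto_metrizable_ae atTop
    (fun n => h.aemeasurable_pointProd_simpleFunc hB hvB (hg.stronglyMeasurable.approx n)) ?_
  filter_upwards [h.ae_finite hB hvB] with ω hω
  exact tendsto_pointProd hω hg.stronglyMeasurable.tendsto_approx

/-- The set `A` and the level sets of `g` in `B` are disjoint, so their counts are independent and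
the expectation factors into one Poisson computation per cell. -/
theorem integral_indicator_mul_pointProd_simpleFunc (h : IsHomogeneousPPP μ lam d)
    {A B : Set Plane} (hA : MeasurableSet A) (hvA : volume A ≠ ∞) (hB : MeasurableSet B)
    (hvB : volume B ≠ ∞) (hAB : Disjoint A B) (g : SimpleFunc Plane ℝ) :
    ∫ ω, (if pointCount d A ω = 1 then 1 else 0) * pointProd d B g ω ∂μ =
      lam * volume.real A * Real.exp (-(lam * volume.real A)) *
        Real.exp (-(lam * ∫ x in B, (1 - g x))) := by
  classical
  -- The index `none` stands for `A`, and `some v` for the part of `B` where `g = v`.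
  let C : Option g.range → Set Plane := fun o => o.elim A fun v => B ∩ g ⁻¹' {v.1}
  let φ : Option g.range → ℕ∞ → ℝ := fun o n =>
    o.elim (if n = 1 then 1 else 0) fun v => v.1 ^ n.toNat
  have hsub : ∀ v, volume (B ∩ g ⁻¹' {v}) ≠ ∞ := fun v =>
    ((measure_mono inter_subset_left).trans_lt hvB.lt_top).ne
  have hC : ∀ o, MeasurableSet (C o) := by
    rintro (_ | v)
    exacts [hA, hB.inter (g.measurableSet_preimage _)]
  have hvC : ∀ o, volume (C o) ≠ ∞ := by
    rintro (_ | v)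
    exacts [hvA, hsub _]
  have hdC : Pairwise fun i j => Disjoint (C i) (C j) := by
    rintro (_ | v) (_ | w) hvw
    · exact absurd rfl hvw
    · exact hAB.mono_right inter_subset_left
    · exact (hAB.mono_right inter_subset_left).symm
    · refine Set.disjoint_left.2 fun x hx hx' => hvw ?_
      congr 1
      exact Subtype.ext (hx.2.symm.trans hx'.2)
  have hind := h.iIndepFun_pointCount C hC hvC hdC
  have key := hind.integral_fun_prod_comp (𝕜 := ℝ) (f := φ)
    (fun o => h.aemeasurable_pointCount (hC o) (hvC o))
    (fun o => Measurable.of_discrete.aestronglyMeasurable)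
  simp only [Fintype.prod_option] at key
  have hl : ∫ ω, (if pointCount d A ω = 1 then 1 else 0) * pointProd d B g ω ∂μ =
      ∫ ω, φ none (pointCount d (C none) ω) *
        ∏ v : g.range, φ (some v) (pointCount d (C (some v)) ω) ∂μ := by
    refine integral_congr_ae ?_
    filter_upwards [h.ae_finite hB hvB] with ω hω
    rw [pointProd_simpleFunc hω,
      ← Finset.prod_coe_sort g.range fun v => v ^ (pointCount d (B ∩ g ⁻¹' {v}) ω).toNat]
    rfl
  rw [hl, key]
  congr 1
  · rw [h.integral_comp_pointCount (hC _) (hvC _)]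
    have := integral_indicator_one_poissonMeasure (lam * (volume A).toNNReal)
    simp only [NNReal.coe_mul] at this
    simp only [φ, Option.elim, Nat.cast_eq_one]
    exact this
  · have h1 : ∀ v : g.range, ∫ ω, φ (some v) (pointCount d (C (some v)) ω) ∂μ =
        Real.exp (-(lam * volume.real (B ∩ g ⁻¹' {v.1}) * (1 - v.1))) := by
      intro v
      rw [h.integral_comp_pointCount (hC _) (hvC _)]
      simp only [φ, Option.elim, ENat.toNat_natCast]
      rw [integral_pow_poissonMeasure]
      rfl
    simp_rw [h1]
    rw [Finset.prod_coe_sort g.range fun v =>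
      Real.exp (-(lam * volume.real (B ∩ g ⁻¹' {v}) * (1 - v))), ← Real.exp_sum]
    congr 1
    have : IsFiniteMeasure (volume.restrict B) := isFiniteMeasure_restrict.2 hvB
    have hsum : ∀ x, 1 - g x = ∑ v ∈ g.range, (g ⁻¹' {v}).indicator (fun _ => 1 - v) x := by
      intro x
      rw [Finset.sum_eq_single_of_mem (g x) (g.mem_range_self x)
        (fun v _ hv => indicator_of_notMem (fun hx => hv hx.symm) _)]
      exact (indicator_of_mem (s := g ⁻¹' {g x}) (f := fun _ => 1 - g x) rfl).symm
    simp_rw [hsum]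
    rw [integral_finsetSum _ fun v _ =>
      (integrable_const _).indicator (g.measurableSet_preimage _), Finset.mul_sum,
      ← Finset.sum_neg_distrib]
    refine Finset.sum_congr rfl fun v _ => ?_
    rw [integral_indicator_const _ (g.measurableSet_preimage _), smul_eq_mul,
      measureReal_restrict_apply (g.measurableSet_preimage _), inter_comm, mul_assoc]

variable [IsProbabilityMeasure μ]

/-- Bounded simple approximations of `g` and dominated convergence on both sides; the finite area of
`B` makes constants admissible bounds. -/
theorem integral_indicator_mul_pointProd (h : IsHomogeneousPPP μ lam d)
    {A B : Set Plane} (hA : MeasurableSet A) (hvA : volume A ≠ ∞) (hB : MeasurableSet B)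
    (hvB : volume B ≠ ∞) (hAB : Disjoint A B) {g : Plane → ℝ} (hg : Measurable g)
    (hg1 : ∀ x, |g x| ≤ 1) :
    ∫ ω, (if pointCount d A ω = 1 then 1 else 0) * pointProd d B g ω ∂μ =
      lam * volume.real A * Real.exp (-(lam * volume.real A)) *
        Real.exp (-(lam * ∫ x in B, (1 - g x))) := by
  have hgs : StronglyMeasurable g := hg.stronglyMeasurable
  let G := hgs.approxBounded 1
  have hG : ∀ x, Tendsto (fun n => G n x) atTop (𝓝 (g x)) := fun x =>
    hgs.tendsto_approxBounded_of_norm_le (hg1 x)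
  have hG1 : ∀ n x, |G n x| ≤ 1 := fun n x => hgs.norm_approxBounded_le zero_le_one n x
  have hA1 : AEMeasurable (fun ω => if pointCount d A ω = 1 then (1 : ℝ) else 0) μ :=
    (Measurable.of_discrete (f := fun n : ℕ∞ => if n = 1 then (1 : ℝ) else 0)).comp_aemeasurable
      (h.aemeasurable_pointCount hA hvA)
  have : IsFiniteMeasure (volume.restrict B) := isFiniteMeasure_restrict.2 hvB
  have hl : Tendsto (fun n => ∫ ω, (if pointCount d A ω = 1 then 1 else 0) *
      pointProd d B (G n) ω ∂μ) atTop
      (𝓝 (∫ ω, (if pointCount d A ω = 1 then 1 else 0) * pointProd d B g ω ∂μ)) := by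
    refine tendsto_integral_of_dominated_convergence (fun _ => 1) (fun n =>
      (hA1.mul (h.aemeasurable_pointProd_simpleFunc hB hvB _)).aestronglyMeasurable)
      (integrable_const _) (fun n => ?_) ?_
    · filter_upwards [h.ae_finite hB hvB] with ω hω
      rw [norm_mul]
      refine mul_le_one₀ ?_ (norm_nonneg _) (abs_pointProd_le_one hω (hG1 n))
      split_ifs <;> simp
    · filter_upwards [h.ae_finite hB hvB] with ω hω
      exact (tendsto_pointProd hω hG).const_mul _
  have hr : Tendsto (fun n => ∫ x in B, (1 - G n x)) atTop (𝓝 (∫ x in B, (1 - g x))) := by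
    refine tendsto_integral_of_dominated_convergence (fun _ => 2) (fun n =>
      (measurable_const.sub (G n).measurable).aestronglyMeasurable)
      (integrable_const _) (fun n => ?_) ?_
    · filter_upwards with x
      have := abs_le.1 (hG1 n x)
      rw [Real.norm_eq_abs, abs_le]
      constructor <;> linarith
    · filter_upwards with x
      exact (hG x).const_sub _
  refine tendsto_nhds_unique hl ?_
  simp_rw [h.integral_indicator_mul_pointProd_simpleFunc hA hvA hB hvB hAB]
  exact ((Real.continuous_exp.tendsto _).comp ((hr.const_mul _).neg)).const_mul _

end IsHomogeneousPPP

/-! ### Joint law of the nearest point and the others, below a cutoff radius. -/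

/-- The annulus of inner radius `r` (included) and outer radius `K` (excluded). -/
def annulus (r K : ℝ) : Set Plane := {x | r ≤ ‖x‖ ∧ ‖x‖ < K}

theorem measurableSet_annulus (r K : ℝ) : MeasurableSet (annulus r K) :=
  (measurableSet_le measurable_const measurable_norm).inter
    (measurableSet_lt measurable_norm measurable_const)

theorem annulus_subset_ball (r K : ℝ) : annulus r K ⊆ ball 0 K := fun _ hx =>
  mem_ball_zero_iff.2 hx.2

theorem volume_annulus_ne_top (r K : ℝ) : volume (annulus r K) ≠ ∞ :=
  ((measure_mono (annulus_subset_ball r K)).trans_lt measure_ball_lt_top).ne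

namespace IsHomogeneousPPP

variable {Ω : Type*} [MeasurableSpace Ω] {μ : Measure Ω} {lam : ℝ≥0} {d : ℕ → Ω → Plane}

theorem measurableSet_nearest_mem (h : IsHomogeneousPPP μ lam d) {A : Set Plane}
    (hA : MeasurableSet A) (R : ℝ) :
    MeasurableSet {ω | d 0 ω ∈ A ∧ ∀ j, 1 ≤ j → R ≤ ‖d j ω‖} := by
  have h1 : {ω | d 0 ω ∈ A ∧ ∀ j, 1 ≤ j → R ≤ ‖d j ω‖} =
      d 0 ⁻¹' A ∩ ⋂ j, ⋂ (_ : 1 ≤ j), {ω | R ≤ ‖d j ω‖} := by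
    ext; simp
  rw [h1]
  exact (h.measurable_point 0 hA).inter (MeasurableSet.iInter fun j => MeasurableSet.iInter fun _ =>
    measurableSet_le measurable_const (h.measurable_point j).norm)

variable [IsProbabilityMeasure μ]

/-- Almost surely the event says that `A` holds exactly one point and the rest of the ball of radius
`R` none. The emptiness is encoded in the product: `g` is replaced by 0 inside the ball, so that a
single point there makes the product vanish. -/
theorem setIntegral_nearest_mem_cell (h : IsHomogeneousPPP μ lam d)
    (hs : ∀ᵐ ω ∂μ, Monotone fun i => ‖d i ω‖) {A : Set Plane} (hA : MeasurableSet A) {R K : ℝ}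
    (hAR : A ⊆ ball 0 R) {g : Plane → ℝ} (hg : Measurable g) (hg1 : ∀ x, |g x| ≤ 1) :
    ∫ ω in {ω | d 0 ω ∈ A ∧ ∀ j, 1 ≤ j → R ≤ ‖d j ω‖}, pointProd d (annulus R K) g ω ∂μ =
      volume.real A * (lam * Real.exp (-(lam * volume.real (ball (0 : Plane) R))) *
        Real.exp (-(lam * ∫ y in annulus R K, (1 - g y)))) := by
  set B : Set Plane := (ball 0 R ∪ annulus R K) \ A with hBdef
  have hfin : volume (ball (0 : Plane) R ∪ annulus R K) ≠ ∞ :=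
    (measure_union_lt_top measure_ball_lt_top (volume_annulus_ne_top R K).lt_top).ne
  have hB : MeasurableSet B := (measurableSet_ball.union (measurableSet_annulus R K)).diff hA
  have hvB : volume B ≠ ∞ := ((measure_mono sdiff_subset).trans_lt hfin.lt_top).ne
  have hvA : volume A ≠ ∞ := ((measure_mono hAR).trans_lt measure_ball_lt_top).ne
  have hgR : MeasurableSet {x : Plane | R ≤ ‖x‖} := measurableSet_le measurable_const measurable_norm
  set g' : Plane → ℝ := indicator {x | R ≤ ‖x‖} g with hg'
  have hann : annulus R K ∩ A = ∅ := by
    ext x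
    simp only [mem_inter_iff, mem_empty_iff_false, iff_false, not_and]
    intro hx hxA
    exact absurd (mem_ball_zero_iff.1 (hAR hxA)) hx.1.not_gt
  have key := h.integral_indicator_mul_pointProd hA hvA hB hvB disjoint_sdiff_right
    (hg.indicator hgR) (g := g') (fun x => by
      by_cases hx : x ∈ {x : Plane | R ≤ ‖x‖}
      · rw [hg', indicator_of_mem hx]; exact hg1 x
      · rw [hg', indicator_of_notMem hx]; simp)
  have hl : ∫ ω in {ω | d 0 ω ∈ A ∧ ∀ j, 1 ≤ j → R ≤ ‖d j ω‖}, pointProd d (annulus R K) g ω ∂μ =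
      ∫ ω, (if pointCount d A ω = 1 then 1 else 0) * pointProd d B g' ω ∂μ := by
    rw [← integral_indicator (h.measurableSet_nearest_mem hA R)]
    refine integral_congr_ae ?_
    filter_upwards [hs, h.ae_finite hB hvB] with ω hω hfinω
    by_cases hC : d 0 ω ∈ A ∧ ∀ j, 1 ≤ j → R ≤ ‖d j ω‖
    · rw [indicator_of_mem (s := {ω | d 0 ω ∈ A ∧ ∀ j, 1 ≤ j → R ≤ ‖d j ω‖}) hC]
      have h1 : {i : ℕ | d i ω ∈ A} = {0} := by
        ext i
        simp only [mem_ofPred_eq, mem_singleton_iff]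
        refine ⟨fun hi => ?_, fun hi => hi ▸ hC.1⟩
        by_contra hi0
        exact absurd (mem_ball_zero_iff.1 (hAR hi)) (hC.2 i (Nat.pos_of_ne_zero hi0)).not_gt
      have hN : pointCount d A ω = 1 := by rw [pointCount, h1, encard_singleton]
      rw [if_pos hN, one_mul]
      have h2 : {j : ℕ | d j ω ∈ B} = {j : ℕ | d j ω ∈ annulus R K} := by
        ext j
        simp only [mem_ofPred_eq, hBdef]
        constructor
        · rintro ⟨hj | hj, hjA⟩
          · have hj0 : 1 ≤ j := Nat.pos_of_ne_zero fun h0 => hjA (h0 ▸ hC.1)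
            exact absurd (mem_ball_zero_iff.1 hj) (hC.2 j hj0).not_gt
          · exact hj
        · exact fun hj => ⟨Or.inr hj, fun hjA => (hann.subset ⟨hj, hjA⟩).elim⟩
      rw [pointProd, pointProd, h2]
      refine finprod_mem_congr rfl fun j hj => ?_
      rw [hg', indicator_of_mem (s := {x : Plane | R ≤ ‖x‖}) hj.1]
    · rw [indicator_of_notMem (s := {ω | d 0 ω ∈ A ∧ ∀ j, 1 ≤ j → R ≤ ‖d j ω‖}) hC]
      split_ifs with hN
      · obtain ⟨i, hi⟩ := encard_eq_one.1 hN
        have hmem : d i ω ∈ A := hi.superset rfl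
        have hex : ∃ j, d j ω ∈ B ∧ ‖d j ω‖ < R := by
          by_cases hi0 : i = 0
          · subst hi0
            push Not at hC
            obtain ⟨j, hj1, hjR⟩ := hC hmem
            refine ⟨j, ⟨Or.inl (mem_ball_zero_iff.2 hjR), fun hjA => ?_⟩, hjR⟩
            exact absurd (hi.subset hjA) (by simp; omega)
          -- The ordering of the points enters here: if the lone point of `A` has index other than
          -- 0, then `d 0` is at least as close to the origin and kills the product.
          · have h0R : ‖d 0 ω‖ < R :=
              (hω (Nat.zero_le i)).trans_lt (mem_ball_zero_iff.1 (hAR hmem))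
            exact ⟨0, ⟨Or.inl (mem_ball_zero_iff.2 h0R),
              fun h0A => hi0 (hi.subset h0A).symm⟩, h0R⟩
        obtain ⟨j, hjB, hjR⟩ := hex
        rw [one_mul, pointProd_eq_prod hfinω,
          Finset.prod_eq_zero (i := j) (by simpa using hjB)
            (indicator_of_notMem (s := {x : Plane | R ≤ ‖x‖}) (by simpa using hjR) g)]
      · rw [zero_mul]
  rw [hl, key]
  -- The term with the area of `A` cancels the factor exp(-λ|A|) from the count in `A`, leaving the
  -- void probability of the full ball.
  have hsplit : ∫ x in B, (1 - g' x) =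
      (volume.real (ball (0 : Plane) R) - volume.real A) + ∫ y in annulus R K, (1 - g y) := by
    have hBu : B = (ball 0 R \ A) ∪ annulus R K := by
      rw [hBdef, union_sdiff_distrib, sdiff_eq_left.2 (disjoint_iff_inter_eq_empty.2 hann)]
    have hdisj : Disjoint (ball 0 R \ A) (annulus R K) :=
      disjoint_left.2 fun x hx hx' => absurd (mem_ball_zero_iff.1 hx.1) hx'.1.not_gt
    have hfB : IsFiniteMeasure (volume.restrict B) := isFiniteMeasure_restrict.2 hvB
    have hint : IntegrableOn (fun x => 1 - g' x) B := by
      refine Integrable.of_bound (measurable_const.sub (hg.indicator hgR)).aestronglyMeasurable 2 ?_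
      filter_upwards with x
      have : |g' x| ≤ 1 := by
        by_cases hx : x ∈ {x : Plane | R ≤ ‖x‖}
        · rw [hg', indicator_of_mem hx]; exact hg1 x
        · rw [hg', indicator_of_notMem hx]; simp
      rw [abs_le] at this
      rw [Real.norm_eq_abs, abs_le]
      constructor <;> linarith
    rw [hBu] at hint ⊢
    rw [setIntegral_union hdisj (measurableSet_annulus R K) hint.left_of_union
      hint.right_of_union]
    congr 1
    · rw [setIntegral_congr_fun (g := fun _ => (1 : ℝ)) (measurableSet_ball.diff hA)]
      · rw [setIntegral_const, smul_eq_mul, mul_one,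
          measureReal_sdiff hAR hA measure_ball_lt_top.ne]
      · intro x hx
        have : x ∉ {x : Plane | R ≤ ‖x‖} := by simpa using hx.1
        simp only [hg', indicator_of_notMem this, sub_zero]
    · refine setIntegral_congr_fun (measurableSet_annulus R K) fun x hx => ?_
      simp only [hg', indicator_of_mem (s := {x : Plane | R ≤ ‖x‖}) hx.1]
  rw [hsplit, mul_assoc, ← Real.exp_add, mul_assoc (lam : ℝ) (Real.exp _), ← Real.exp_add,
    mul_comm (lam : ℝ), mul_assoc]
  congr 3
  ring

/-- The joint law of the nearest point and the remaining points, when the product over the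
remaining points depends on the nearest point only through a discretization `idx`. -/
theorem setIntegral_nearest_discretized (h : IsHomogeneousPPP μ lam d)
    (hs : ∀ᵐ ω ∂μ, Monotone fun i => ‖d i ω‖) {idx : Plane → ℕ} (hidx : Measurable idx)
    {R : ℕ → ℝ} (hR : ∀ x, ‖x‖ < R (idx x)) (K : ℝ) {G : ℕ → Plane → ℝ}
    (hG : ∀ n, Measurable (G n)) (hG1 : ∀ n x, |G n x| ≤ 1) :
    IntegrableOn (fun ω => pointProd d (annulus (R (idx (d 0 ω))) K) (G (idx (d 0 ω))) ω)
      {ω | ‖d 0 ω‖ < K ∧ ∀ j, 1 ≤ j → R (idx (d 0 ω)) ≤ ‖d j ω‖} μ ∧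
    MeasurableSet {ω | ‖d 0 ω‖ < K ∧ ∀ j, 1 ≤ j → R (idx (d 0 ω)) ≤ ‖d j ω‖} ∧
    ∫ ω in {ω | ‖d 0 ω‖ < K ∧ ∀ j, 1 ≤ j → R (idx (d 0 ω)) ≤ ‖d j ω‖},
        pointProd d (annulus (R (idx (d 0 ω))) K) (G (idx (d 0 ω))) ω ∂μ =
      ∫ x in ball (0 : Plane) K,
        lam * Real.exp (-(lam * volume.real (ball (0 : Plane) (R (idx x))))) *
          Real.exp (-(lam * ∫ y in annulus (R (idx x)) K, (1 - G (idx x) y))) := by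
  set F : Ω → ℝ :=
    fun ω => pointProd d (annulus (R (idx (d 0 ω))) K) (G (idx (d 0 ω))) ω with hF
  set A : ℕ → Set Plane := fun n => ball 0 K ∩ idx ⁻¹' {n} with hAdef
  set E : ℕ → Set Ω := fun n => {ω | d 0 ω ∈ A n ∧ ∀ j, 1 ≤ j → R n ≤ ‖d j ω‖} with hEdef
  set T : Set Ω := {ω | ‖d 0 ω‖ < K ∧ ∀ j, 1 ≤ j → R (idx (d 0 ω)) ≤ ‖d j ω‖} with hTdef
  have hA : ∀ n, MeasurableSet (A n) := fun n =>
    measurableSet_ball.inter (hidx (measurableSet_singleton n))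
  have hE : ∀ n, MeasurableSet (E n) := fun n => h.measurableSet_nearest_mem (hA n) (R n)
  have hAd : Pairwise (Function.onFun Disjoint A) := fun m n hmn =>
    disjoint_left.2 fun x hx hx' => hmn (hx.2.symm.trans hx'.2)
  have hEd : Pairwise (Function.onFun Disjoint E) := fun m n hmn =>
    disjoint_left.2 fun x hx hx' => hmn (hx.1.2.symm.trans hx'.1.2)
  have hAu : ⋃ n, A n = ball 0 K := by
    ext x; simp [hAdef]
  have hEu : ⋃ n, E n = T := by
    ext ω
    simp only [mem_iUnion, hEdef, hTdef, hAdef, mem_ofPred_eq, mem_inter_iff,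
      mem_ball_zero_iff, mem_preimage, mem_singleton_iff]
    constructor
    · rintro ⟨n, ⟨h1, rfl⟩, h2⟩
      exact ⟨h1, h2⟩
    · rintro ⟨h1, h2⟩
      exact ⟨_, ⟨h1, rfl⟩, h2⟩
  have hFE : ∀ n, EqOn F (pointProd d (annulus (R n) K) (G n)) (E n) := by
    rintro n ω ⟨⟨-, hn⟩, -⟩
    simp only [hF, show idx (d 0 ω) = n from hn]
  have hT : MeasurableSet T := hEu ▸ MeasurableSet.iUnion hE
  have hFm : AEStronglyMeasurable F (μ.restrict T) := by
    rw [← hEu, aestronglyMeasurable_iUnion_iff]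
    intro n
    refine ((h.aemeasurable_pointProd (measurableSet_annulus (R n) K)
      (volume_annulus_ne_top _ _) (hG n)).aestronglyMeasurable.restrict (s := E n)).congr ?_
    filter_upwards [ae_restrict_mem (hE n)] with ω hω
    exact (hFE n hω).symm
  have hFi : IntegrableOn F T μ := by
    refine Integrable.of_bound hFm 1 (ae_restrict_of_ae ?_)
    filter_upwards [h.ae_finite (measurableSet_ball (x := (0 : Plane)) (ε := K))
      measure_ball_lt_top.ne] with ω hω
    exact abs_pointProd_le_one (B := annulus (R (idx (d 0 ω))) K) (d := d)
      (hω.subset fun j hj => annulus_subset_ball _ _ hj) (hG1 _)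
  refine ⟨hFi, hT, ?_⟩
  set H : ℕ → ℝ := fun n => lam * Real.exp (-(lam * volume.real (ball (0 : Plane) (R n)))) *
    Real.exp (-(lam * ∫ y in annulus (R n) K, (1 - G n y))) with hH
  have hHi : IntegrableOn (fun x => H (idx x)) (ball (0 : Plane) K) := by
    have : IsFiniteMeasure (volume.restrict (ball (0 : Plane) K)) :=
      isFiniteMeasure_restrict.2 measure_ball_lt_top.ne
    refine Integrable.of_bound
      ((Measurable.of_discrete (f := H)).comp hidx).aestronglyMeasurable lam ?_
    filter_upwards with x
    have h1 : 0 ≤ ∫ y in annulus (R (idx x)) K, (1 - G (idx x) y) :=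
      integral_nonneg fun y => by have := (abs_le.1 (hG1 (idx x) y)).2; simpa using this
    have h2 : Real.exp (-(lam * volume.real (ball (0 : Plane) (R (idx x))))) ≤ 1 :=
      Real.exp_le_one_iff.2 (neg_nonpos.2 (by positivity))
    have h3 : Real.exp (-(lam * ∫ y in annulus (R (idx x)) K, (1 - G (idx x) y))) ≤ 1 :=
      Real.exp_le_one_iff.2 (neg_nonpos.2 (by positivity))
    rw [hH, Real.norm_of_nonneg (by positivity)]
    simpa using mul_le_mul (mul_le_mul_of_nonneg_left h2 lam.coe_nonneg) h3 (Real.exp_pos _).le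
      (by positivity)
  rw [← hEu, integral_iUnion hE hEd (hEu ▸ hFi), ← hAu,
    integral_iUnion hA hAd (hAu ▸ hHi)]
  refine tsum_congr fun n => ?_
  rw [setIntegral_congr_fun (hE n) (hFE n), h.setIntegral_nearest_mem_cell hs (hA n)
    (fun x hx => mem_ball_zero_iff.2 ((show idx x = n from hx.2) ▸ hR x)) (hG n) (hG1 n),
    setIntegral_congr_fun (g := fun _ => H n) (hA n), setIntegral_const, smul_eq_mul]
  rintro x ⟨-, hx⟩
  simp only [show idx x = n from hx]
  rfl

end IsHomogeneousPPP

/-- Taking the first term of the dense sequence within ε gives a countable measurable partition into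
small cells. -/
theorem exists_measurable_index_dist_lt {α : Type*} [PseudoMetricSpace α] [MeasurableSpace α]
    [OpensMeasurableSpace α] (u : ℕ → α) (hu : DenseRange u) {ε : ℝ} (hε : 0 < ε) :
    ∃ idx : α → ℕ, Measurable idx ∧ ∀ x, dist x (u (idx x)) < ε := by
  classical
  have hex : ∀ x, ∃ n, dist x (u n) < ε := fun x => hu.exists_dist_lt x hε
  exact ⟨fun x => Nat.find (hex x), measurable_find hex fun k =>
    (isOpen_lt (by fun_prop) continuous_const).measurableSet, fun x => Nat.find_spec (hex x)⟩

theorem volume_real_ball_plane {r : ℝ} (hr : 0 ≤ r) :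
    volume.real (ball (0 : Plane) r) = Real.pi * r ^ 2 := by
  rw [measureReal_def, EuclideanSpace.volume_ball_fin_two]
  simp [ENNReal.toReal_mul, hr, mul_comm, Real.pi_pos.le]

namespace IsHomogeneousPPP

variable {Ω : Type*} [MeasurableSpace Ω] {μ : Measure Ω} {lam : ℝ≥0} {d : ℕ → Ω → Plane}
variable [IsProbabilityMeasure μ]

/-- The nearest point is replaced by a nearby term of a dense sequence, where the discretized
formula is exact, and the mesh tends to 0. Continuity of `g` in its first variable is needed only at
pairs with ‖x‖ < ‖y‖, since the limit event separates `d 0` from all other points. -/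
theorem integral_nearest_truncated (h : IsHomogeneousPPP μ lam d)
    (hs : ∀ᵐ ω ∂μ, Monotone fun i => ‖d i ω‖) (K : ℝ) {g : Plane → Plane → ℝ}
    (hg : ∀ x, Measurable (g x)) (hg1 : ∀ x y, |g x y| ≤ 1)
    (hgc : ∀ x y, ‖x‖ < ‖y‖ → ContinuousAt (fun x => g x y) x) :
    ∫ ω in {ω | ‖d 0 ω‖ < K ∧ ‖d 0 ω‖ < ‖d 1 ω‖},
        ∏ᶠ j ∈ {j : ℕ | 1 ≤ j ∧ ‖d j ω‖ < K}, g (d 0 ω) (d j ω) ∂μ =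
      ∫ x in ball (0 : Plane) K, lam * Real.exp (-(lam * (Real.pi * ‖x‖ ^ 2))) *
          Real.exp (-(lam * ∫ y in {y : Plane | ‖x‖ < ‖y‖ ∧ ‖y‖ < K}, (1 - g x y))) := by
  obtain ⟨u, hu⟩ := TopologicalSpace.exists_dense_seq Plane
  set ε : ℕ → ℝ := fun m => 1 / ((m : ℝ) + 1) with hε
  have hε0 : ∀ m, 0 < ε m := fun m => by positivity
  have hεt : Tendsto ε atTop (𝓝 0) := tendsto_one_div_add_atTop_nhds_zero_nat
  choose idx hidx hdist using fun m => exists_measurable_index_dist_lt u hu (hε0 m)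
  set q : ℕ → Plane → Plane := fun m x => u (idx m x) with hq
  have hqt : ∀ x, Tendsto (fun m => q m x) atTop (𝓝 x) := fun x => by
    rw [tendsto_iff_dist_tendsto_zero]
    exact squeeze_zero (fun _ => dist_nonneg) (fun m => by rw [dist_comm]; exact (hdist m x).le) hεt
  -- The added ε makes the radius exceed the norm of every point of the cell, so the cell lies in
  -- the open ball of radius `R`.
  set R : ℕ → ℕ → ℝ := fun m n => ‖u n‖ + ε m with hRdef
  have hR : ∀ m x, ‖x‖ < R m (idx m x) := fun m x => by
    have := hdist m x
    rw [dist_eq_norm] at this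
    have h2 := norm_sub_norm_le x (u (idx m x))
    simp only [hRdef]
    linarith
  have hRt : ∀ x, Tendsto (fun m => R m (idx m x)) atTop (𝓝 ‖x‖) := fun x => by
    simpa using (hqt x).norm.add hεt
  set F : ℕ → Ω → ℝ := fun m ω => pointProd d (annulus (R m (idx m (d 0 ω))) K)
    (g (q m (d 0 ω))) ω with hF
  set T : ℕ → Set Ω := fun m =>
    {ω | ‖d 0 ω‖ < K ∧ ∀ j, 1 ≤ j → R m (idx m (d 0 ω)) ≤ ‖d j ω‖} with hTdef
  have key : ∀ m, IntegrableOn (F m) (T m) μ ∧ MeasurableSet (T m) ∧ ∫ ω in T m, F m ω ∂μ =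
      ∫ x in ball (0 : Plane) K,
        lam * Real.exp (-(lam * volume.real (ball (0 : Plane) (R m (idx m x))))) *
          Real.exp (-(lam * ∫ y in annulus (R m (idx m x)) K, (1 - g (q m x) y))) := fun m =>
    h.setIntegral_nearest_discretized hs (hidx m) (hR m) K (G := fun n => g (u n))
      (fun n => hg _) (fun n => hg1 _)
  have hT0 : MeasurableSet {ω | ‖d 0 ω‖ < K ∧ ‖d 0 ω‖ < ‖d 1 ω‖} :=
    (measurableSet_lt (h.measurable_point 0).norm measurable_const).inter
      (measurableSet_lt (h.measurable_point 0).norm (h.measurable_point 1).norm)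
  have hl : Tendsto (fun m => ∫ ω in T m, F m ω ∂μ) atTop
      (𝓝 (∫ ω in {ω | ‖d 0 ω‖ < K ∧ ‖d 0 ω‖ < ‖d 1 ω‖},
        ∏ᶠ j ∈ {j : ℕ | 1 ≤ j ∧ ‖d j ω‖ < K}, g (d 0 ω) (d j ω) ∂μ)) := by
    rw [← integral_indicator hT0]
    simp_rw [fun m => (integral_indicator (key m).2.1 (f := F m) (μ := μ)).symm]
    refine tendsto_integral_of_dominated_convergence (fun _ => 1) (fun m =>
      ((key m).1.integrable_indicator (key m).2.1).aestronglyMeasurable)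
      (integrable_const _) (fun m => ?_) ?_
    · filter_upwards [h.ae_finite (measurableSet_ball (x := (0 : Plane)) (ε := K))
        measure_ball_lt_top.ne] with ω hω
      refine (norm_indicator_le_norm_self _ _).trans ?_
      exact abs_pointProd_le_one (B := annulus (R m (idx m (d 0 ω))) K) (d := d)
        (hω.subset fun j hj => annulus_subset_ball _ _ hj) (hg1 _)
    · filter_upwards [h.ae_finite (measurableSet_ball (x := (0 : Plane)) (ε := K))
        measure_ball_lt_top.ne, hs] with ω hω hsω
      by_cases hC : ‖d 0 ω‖ < K ∧ ‖d 0 ω‖ < ‖d 1 ω‖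
      · rw [indicator_of_mem (s := {ω | ‖d 0 ω‖ < K ∧ ‖d 0 ω‖ < ‖d 1 ω‖}) hC]
        have hfin : {j : ℕ | 1 ≤ j ∧ ‖d j ω‖ < K}.Finite :=
          hω.subset fun j hj => mem_ball_zero_iff.2 hj.2
        have heq : ∏ᶠ (j : ℕ) (_ : 1 ≤ j ∧ ‖d j ω‖ < K), g (d 0 ω) (d j ω) =
            ∏ j ∈ hfin.toFinset, g (d 0 ω) (d j ω) := finprod_mem_eq_finite_toFinset_prod _ hfin
        rw [heq]
        have hlim : Tendsto (fun m => ∏ j ∈ hfin.toFinset, g (q m (d 0 ω)) (d j ω)) atTop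
            (𝓝 (∏ j ∈ hfin.toFinset, g (d 0 ω) (d j ω))) := by
          refine tendsto_finsetProd _ fun j hj => ?_
          have hj1 : 1 ≤ j := ((hfin.mem_toFinset).1 hj).1
          exact (hgc (d 0 ω) (d j ω) (hC.2.trans_le (hsω hj1))).tendsto.comp (hqt _)
        refine hlim.congr' ?_
        -- Once the radius is below ‖d 1 ω‖, the annulus contains exactly the points of index at
        -- least 1 and norm below `K`.
        filter_upwards [(hRt (d 0 ω)).eventually_lt_const hC.2] with m hm
        have hmem : ω ∈ T m := ⟨hC.1, fun j hj => hm.le.trans (hsω hj)⟩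
        rw [indicator_of_mem hmem]
        have hset : {j : ℕ | d j ω ∈ annulus (R m (idx m (d 0 ω))) K} =
            {j : ℕ | 1 ≤ j ∧ ‖d j ω‖ < K} := by
          ext j
          refine ⟨fun hj => ⟨?_, hj.2⟩, fun hj => ⟨hmem.2 j hj.1, hj.2⟩⟩
          by_contra hj0
          have : j = 0 := by omega
          subst this
          exact absurd (hR m (d 0 ω)) hj.1.not_gt
        simp only [hF, pointProd, hset]
        rw [finprod_mem_eq_finite_toFinset_prod _ hfin]
      · rw [indicator_of_notMem (s := {ω | ‖d 0 ω‖ < K ∧ ‖d 0 ω‖ < ‖d 1 ω‖}) hC]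
        refine tendsto_const_nhds.congr fun m => ?_
        rw [indicator_of_notMem]
        exact fun hm => hC ⟨hm.1, (hR m _).trans_le (hm.2 1 le_rfl)⟩
  have hr : Tendsto (fun m => ∫ x in ball (0 : Plane) K,
        lam * Real.exp (-(lam * volume.real (ball (0 : Plane) (R m (idx m x))))) *
          Real.exp (-(lam * ∫ y in annulus (R m (idx m x)) K, (1 - g (q m x) y)))) atTop
      (𝓝 (∫ x in ball (0 : Plane) K, lam * Real.exp (-(lam * (Real.pi * ‖x‖ ^ 2))) *
          Real.exp (-(lam * ∫ y in {y : Plane | ‖x‖ < ‖y‖ ∧ ‖y‖ < K}, (1 - g x y))))) := by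
    have : IsFiniteMeasure (volume.restrict (ball (0 : Plane) K)) :=
      isFiniteMeasure_restrict.2 measure_ball_lt_top.ne
    have hnn : ∀ x y, 0 ≤ 1 - g x y := fun x y => sub_nonneg.2 (abs_le.1 (hg1 x y)).2
    refine tendsto_integral_of_dominated_convergence (fun _ => (lam : ℝ)) (fun m => ?_)
      (integrable_const _) (fun m => ?_) ?_
    · let H : ℕ → ℝ := fun n => lam * Real.exp (-(lam * volume.real (ball (0 : Plane) (R m n)))) *
        Real.exp (-(lam * ∫ y in annulus (R m n) K, (1 - g (u n) y)))
      exact ((Measurable.of_discrete (f := H)).comp (hidx m)).aestronglyMeasurable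
    · filter_upwards with x
      have h1 : 0 ≤ ∫ y in annulus (R m (idx m x)) K, (1 - g (q m x) y) :=
        integral_nonneg fun y => hnn _ _
      have h2 : Real.exp (-(lam * volume.real (ball (0 : Plane) (R m (idx m x))))) ≤ 1 :=
        Real.exp_le_one_iff.2 (neg_nonpos.2 (by positivity))
      have h3 : Real.exp (-(lam * ∫ y in annulus (R m (idx m x)) K, (1 - g (q m x) y))) ≤ 1 :=
        Real.exp_le_one_iff.2 (neg_nonpos.2 (by positivity))
      rw [Real.norm_of_nonneg (by positivity)]
      simpa using mul_le_mul (mul_le_mul_of_nonneg_left h2 lam.coe_nonneg) h3 (Real.exp_pos _).le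
        (by positivity)
    · filter_upwards with x
      have hv : Tendsto (fun m => volume.real (ball (0 : Plane) (R m (idx m x)))) atTop
          (𝓝 (Real.pi * ‖x‖ ^ 2)) := by
        simp_rw [fun m => volume_real_ball_plane ((norm_nonneg x).trans (hR m x).le)]
        exact ((hRt x).pow 2).const_mul _
      have hi : Tendsto (fun m => ∫ y in annulus (R m (idx m x)) K, (1 - g (q m x) y)) atTop
          (𝓝 (∫ y in {y : Plane | ‖x‖ < ‖y‖ ∧ ‖y‖ < K}, (1 - g x y))) := by
        have hS : MeasurableSet {y : Plane | ‖x‖ < ‖y‖ ∧ ‖y‖ < K} :=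
          (measurableSet_lt measurable_const measurable_norm).inter
            (measurableSet_lt measurable_norm measurable_const)
        rw [← integral_indicator hS]
        simp_rw [fun m => (integral_indicator (measurableSet_annulus (R m (idx m x)) K)
          (f := fun y => 1 - g (q m x) y) (μ := volume)).symm]
        refine tendsto_integral_of_dominated_convergence
          (indicator (ball (0 : Plane) K) fun _ => (2 : ℝ)) (fun m =>
            ((measurable_const.sub (hg _)).indicator
              (measurableSet_annulus _ _)).aestronglyMeasurable)
          ((integrable_indicator_iff measurableSet_ball).2 (integrable_const _))
          (fun m => ?_) ?_
        · filter_upwards with y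
          rw [norm_indicator_eq_indicator_norm]
          refine (indicator_le_indicator_of_subset (annulus_subset_ball _ K)
            (fun _ => norm_nonneg _) y).trans (indicator_le_indicator ?_)
          have := abs_le.1 (hg1 (q m x) y)
          rw [Real.norm_eq_abs, abs_le]
          constructor <;> linarith
        · filter_upwards with y
          by_cases hy : ‖x‖ < ‖y‖ ∧ ‖y‖ < K
          · rw [indicator_of_mem (s := {y : Plane | ‖x‖ < ‖y‖ ∧ ‖y‖ < K}) hy]
            refine (((hgc x y hy.1).tendsto.comp (hqt x)).const_sub 1).congr' ?_
            filter_upwards [(hRt x).eventually_lt_const hy.1] with m hm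
            rw [indicator_of_mem (s := annulus (R m (idx m x)) K) ⟨hm.le, hy.2⟩]
            rfl
          · rw [indicator_of_notMem (s := {y : Plane | ‖x‖ < ‖y‖ ∧ ‖y‖ < K}) hy]
            refine tendsto_const_nhds.congr fun m => ?_
            rw [indicator_of_notMem]
            exact fun hm => hy ⟨(hR m x).trans_le hm.1, hm.2⟩
      exact (((Real.continuous_exp.tendsto _).comp ((hv.const_mul _).neg)).const_mul _).mul
        ((Real.continuous_exp.tendsto _).comp ((hi.const_mul _).neg))
  refine tendsto_nhds_unique hl (hr.congr fun m => (key m).2.2.symm)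

end IsHomogeneousPPP

/-! ### Removing the cutoff radius. -/

theorem integral_exp_neg_pi_mul_sq_norm {lam : ℝ} (hlam : 0 < lam) :
    ∫ x : Plane, lam * Real.exp (-(lam * (Real.pi * ‖x‖ ^ 2))) = 1 := by
  have h := GaussianFourier.integral_rexp_neg_mul_sq_norm (V := Plane)
    (b := lam * Real.pi) (by positivity)
  rw [integral_const_mul]
  have heq : ∀ x : Plane, -(lam * (Real.pi * ‖x‖ ^ 2)) = -(lam * Real.pi) * ‖x‖ ^ 2 :=
    fun x => by ring
  simp_rw [heq, h]
  simp only [finrank_euclideanSpace, Fintype.card_fin, Nat.cast_ofNat]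
  norm_num
  field_simp

theorem integrable_exp_neg_pi_mul_sq_norm {lam : ℝ} (hlam : 0 < lam) :
    Integrable fun x : Plane => lam * Real.exp (-(lam * (Real.pi * ‖x‖ ^ 2))) := by
  by_contra hn
  have := integral_exp_neg_pi_mul_sq_norm hlam
  rw [integral_undef hn] at this
  exact zero_ne_one this

theorem prod_le_prod_of_subset_of_le_one {ι : Type*} {s t : Finset ι} (hst : s ⊆ t) {f : ι → ℝ}
    (h0 : ∀ i, 0 ≤ f i) (h1 : ∀ i, f i ≤ 1) : ∏ i ∈ t, f i ≤ ∏ i ∈ s, f i := by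
  classical
  rw [← Finset.prod_sdiff hst]
  exact mul_le_of_le_one_left (Finset.prod_nonneg fun i _ => h0 i)
    (Finset.prod_le_one (fun i _ => h0 i) fun i _ => h1 i)

/-- Products over an exhausting sequence of finite sets of indices converge to the limit of the
initial products. -/
theorem tendsto_prod_of_exhausting {f : ℕ → ℝ} (h0 : ∀ i, 0 ≤ f i) (h1 : ∀ i, f i ≤ 1) {L : ℝ}
    (hL : Tendsto (fun n => ∏ j ∈ Finset.range n, f (j + 1)) atTop (𝓝 L)) {J : ℕ → Finset ℕ}
    (hJ : ∀ N, ∀ j ∈ J N, 1 ≤ j) (hJe : ∀ j, 1 ≤ j → ∀ᶠ N in atTop, j ∈ J N) :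
    Tendsto (fun N => ∏ j ∈ J N, f j) atTop (𝓝 L) := by
  have heq : ∀ n, ∏ j ∈ Finset.range n, f (j + 1) = ∏ j ∈ Finset.Ico 1 (n + 1), f j := by
    intro n
    rw [Finset.prod_Ico_eq_prod_range]
    simp [add_comm]
  simp_rw [heq] at hL
  have hanti : Antitone fun n => ∏ j ∈ Finset.Ico 1 (n + 1), f j := fun m n hmn =>
    prod_le_prod_of_subset_of_le_one (Finset.Ico_subset_Ico le_rfl (by omega)) h0 h1
  refine tendsto_order.2 ⟨fun a ha => Eventually.of_forall fun N => ha.trans_le ?_, fun a ha => ?_⟩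
  · obtain ⟨n, hn⟩ := (J N).exists_nat_subset_range
    refine (hanti.le_of_tendsto hL n).trans (prod_le_prod_of_subset_of_le_one ?_ h0 h1)
    intro j hj
    have := Finset.mem_range.1 (hn hj)
    exact Finset.mem_Ico.2 ⟨hJ N j hj, by omega⟩
  · obtain ⟨n, hn⟩ := (hL.eventually_lt_const ha).exists
    have : ∀ᶠ N in atTop, ∀ j ∈ Finset.Ico 1 (n + 1), j ∈ J N :=
      (Filter.eventually_all_finset _).2 fun j hj => hJe j (Finset.mem_Ico.1 hj).1
    filter_upwards [this] with N hN
    exact (prod_le_prod_of_subset_of_le_one hN h0 h1).trans_lt hn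

namespace IsHomogeneousPPP

variable {Ω : Type*} [MeasurableSpace Ω] {μ : Measure Ω} {lam : ℝ≥0} {d : ℕ → Ω → Plane}
variable [IsProbabilityMeasure μ]

/-- With `g = 1` the truncated formula computes the probability of the strict inequality below
radius K. The Gaussian density of the nearest point has total mass 1, so nothing is left for ties.
-/
theorem ae_norm_zero_lt_norm_one (h : IsHomogeneousPPP μ lam d) (hlam : 0 < lam)
    (hs : ∀ᵐ ω ∂μ, Monotone fun i => ‖d i ω‖) : ∀ᵐ ω ∂μ, ‖d 0 ω‖ < ‖d 1 ω‖ := by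
  have hK : ∀ K : ℕ, μ.real {ω | ‖d 0 ω‖ < K ∧ ‖d 0 ω‖ < ‖d 1 ω‖} =
      ∫ x in ball (0 : Plane) K, lam * Real.exp (-(lam * (Real.pi * ‖x‖ ^ 2))) := by
    intro K
    have := h.integral_nearest_truncated hs K (g := fun _ _ => 1) (fun _ => measurable_const)
      (by simp) (fun _ _ _ => continuousAt_const)
    simpa using this
  have hlim : Tendsto (fun K : ℕ => ∫ x in ball (0 : Plane) K,
      lam * Real.exp (-(lam * (Real.pi * ‖x‖ ^ 2)))) atTop (𝓝 1) := by
    rw [← integral_exp_neg_pi_mul_sq_norm (NNReal.coe_pos.2 hlam), ← setIntegral_univ,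
      ← iUnion_ball_nat (0 : Plane)]
    exact tendsto_setIntegral_of_monotone (fun _ => measurableSet_ball)
      (fun m n hmn => ball_subset_ball (by exact_mod_cast hmn))
      (integrable_exp_neg_pi_mul_sq_norm (NNReal.coe_pos.2 hlam)).integrableOn
  have hm : MeasurableSet {ω | ‖d 0 ω‖ < ‖d 1 ω‖} :=
    measurableSet_lt (h.measurable_point 0).norm (h.measurable_point 1).norm
  have h1 : 1 ≤ μ.real {ω | ‖d 0 ω‖ < ‖d 1 ω‖} := by
    refine le_of_tendsto' hlim fun K => ?_
    rw [← hK]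
    exact measureReal_mono fun ω hω => hω.2
  have h2 : μ {ω | ‖d 0 ω‖ < ‖d 1 ω‖} = 1 := by
    refine le_antisymm prob_le_one ?_
    rw [measureReal_def, ← ENNReal.toReal_one] at h1
    exact (ENNReal.toReal_le_toReal ENNReal.one_ne_top (measure_ne_top _ _)).1 h1
  exact (mem_ae_iff_prob_eq_one hm).2 h2

/-- The generating functional of the points beyond the nearest one, jointly with the position of
the nearest one. -/
theorem integral_nearest (h : IsHomogeneousPPP μ lam d) (hlam : 0 < lam)
    (hs : ∀ᵐ ω ∂μ, Monotone fun i => ‖d i ω‖) {g : Plane → Plane → ℝ}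
    (hg : Measurable (Function.uncurry g)) (hg0 : ∀ x y, 0 ≤ g x y) (hg1 : ∀ x y, g x y ≤ 1)
    (hgc : ∀ x y, ‖x‖ < ‖y‖ → ContinuousAt (fun x => g x y) x)
    (hgi : ∀ x, IntegrableOn (fun y => 1 - g x y) {y : Plane | ‖x‖ < ‖y‖})
    {L : Ω → ℝ} (hL : ∀ᵐ ω ∂μ,
      Tendsto (fun n => ∏ j ∈ Finset.range n, g (d 0 ω) (d (j + 1) ω)) atTop (𝓝 (L ω))) :
    ∫ ω, L ω ∂μ = ∫ x : Plane, lam * Real.exp (-(lam * (Real.pi * ‖x‖ ^ 2))) *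
          Real.exp (-(lam * ∫ y in {y : Plane | ‖x‖ < ‖y‖}, (1 - g x y))) := by
  have hgabs : ∀ x y, |g x y| ≤ 1 := fun x y => abs_le.2 ⟨by linarith [hg0 x y], hg1 x y⟩
  have hgx : ∀ x, Measurable (g x) := fun x => hg.comp measurable_prodMk_left
  set T : ℕ → Set Ω := fun K => {ω | ‖d 0 ω‖ < K ∧ ‖d 0 ω‖ < ‖d 1 ω‖} with hTdef
  set F : ℕ → Ω → ℝ := fun K ω => ∏ᶠ j ∈ {j : ℕ | 1 ≤ j ∧ ‖d j ω‖ < K}, g (d 0 ω) (d j ω)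
    with hFdef
  have hT : ∀ K, MeasurableSet (T K) := fun K =>
    (measurableSet_lt (h.measurable_point 0).norm measurable_const).inter
      (measurableSet_lt (h.measurable_point 0).norm (h.measurable_point 1).norm)
  have hfin : ∀ᵐ ω ∂μ, ∀ K : ℕ, {j : ℕ | 1 ≤ j ∧ ‖d j ω‖ < K}.Finite := by
    refine ae_all_iff.2 fun K => ?_
    filter_upwards [h.ae_finite (measurableSet_ball (x := (0 : Plane)) (ε := K))
        measure_ball_lt_top.ne] with ω hω
    exact hω.subset fun j hj => mem_ball_zero_iff.2 hj.2
  have hFm : ∀ K, AEMeasurable (F K) μ := by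
    intro K
    -- The product over a random index set is the eventual value of products over fixed index ranges
    -- in which points beyond `K` contribute 1.
    refine aemeasurable_of_tendsto_metrizable_ae atTop (f := fun n ω =>
      ∏ j ∈ Finset.Ico 1 n, if ‖d j ω‖ < K then g (d 0 ω) (d j ω) else 1) (fun n => ?_) ?_
    · refine (Finset.measurable_fun_prod _ fun j _ => Measurable.ite ?_ ?_ ?_).aemeasurable
      · exact measurableSet_lt (h.measurable_point j).norm measurable_const
      · exact hg.comp ((h.measurable_point 0).prodMk (h.measurable_point j))
      · exact measurable_const
    · filter_upwards [hfin] with ω hω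
      obtain ⟨n, hn⟩ := (hω K).toFinset.exists_nat_subset_range
      refine tendsto_const_nhds.congr' ?_
      filter_upwards [eventually_ge_atTop n] with m hm
      have heq : F K ω = ∏ j ∈ (hω K).toFinset, g (d 0 ω) (d j ω) :=
        finprod_mem_eq_finite_toFinset_prod _ (hω K)
      rw [heq, ← Finset.prod_filter]
      refine Finset.prod_congr ?_ fun _ _ => rfl
      ext j
      simp only [Finite.mem_toFinset, mem_ofPred_eq, Finset.mem_filter, Finset.mem_Ico]
      refine ⟨fun hj => ⟨⟨hj.1, ?_⟩, hj.2⟩, fun hj => ⟨hj.1.1, hj.2⟩⟩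
      exact (Finset.mem_range.1 (hn ((hω K).mem_toFinset.2 hj))).trans_le hm
  have hl : Tendsto (fun K : ℕ => ∫ ω in T K, F K ω ∂μ) atTop (𝓝 (∫ ω, L ω ∂μ)) := by
    simp_rw [fun K => (integral_indicator (hT K) (f := F K) (μ := μ)).symm]
    refine tendsto_integral_of_dominated_convergence (fun _ => 1)
      (fun K => ((hFm K).indicator (hT K)).aestronglyMeasurable) (integrable_const _)
      (fun K => ?_) ?_
    · filter_upwards [hfin] with ω hω
      refine (norm_indicator_le_norm_self _ _).trans ?_
      have heq : F K ω = ∏ j ∈ (hω K).toFinset, g (d 0 ω) (d j ω) :=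
        finprod_mem_eq_finite_toFinset_prod _ (hω K)
      rw [heq, Real.norm_eq_abs, Finset.abs_prod]
      exact Finset.prod_le_one (fun _ _ => abs_nonneg _) fun _ _ => hgabs _ _
    · filter_upwards [hfin, hL, h.ae_norm_zero_lt_norm_one hlam hs] with ω hω hLω hlt
      have hconv := tendsto_prod_of_exhausting (f := fun j => g (d 0 ω) (d j ω))
        (fun _ => hg0 _ _) (fun _ => hg1 _ _) hLω (J := fun K => (hω K).toFinset)
        (fun K j hj => ((hω K).mem_toFinset.1 hj).1) (fun j hj => by
          obtain ⟨N, hN⟩ := exists_nat_gt ‖d j ω‖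
          filter_upwards [eventually_ge_atTop N] with K hK
          exact (hω K).mem_toFinset.2 ⟨hj, hN.trans_le (by exact_mod_cast hK)⟩)
      refine hconv.congr' ?_
      obtain ⟨N, hN⟩ := exists_nat_gt ‖d 0 ω‖
      filter_upwards [eventually_ge_atTop N] with K hK
      have hmem : ω ∈ T K := ⟨hN.trans_le (by exact_mod_cast hK), hlt⟩
      rw [indicator_of_mem hmem]
      exact (finprod_mem_eq_finite_toFinset_prod _ (hω K)).symm
  have hS : ∀ (x : Plane), MeasurableSet {y : Plane | ‖x‖ < ‖y‖} := fun x =>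
    measurableSet_lt measurable_const measurable_norm
  have hSK : ∀ (x : Plane) (K : ℕ), MeasurableSet {y : Plane | ‖x‖ < ‖y‖ ∧ ‖y‖ < K} := fun x K =>
    (hS x).inter (measurableSet_lt measurable_norm measurable_const)
  have hIm : ∀ K : ℕ, Measurable fun x : Plane =>
      ∫ y in {y : Plane | ‖x‖ < ‖y‖ ∧ ‖y‖ < K}, (1 - g x y) := by
    intro K
    simp_rw [fun x => (integral_indicator (hSK x K) (f := fun y => 1 - g x y)
      (μ := volume)).symm]
    have hm : Measurable fun p : Plane × Plane =>
        indicator {p : Plane × Plane | ‖p.1‖ < ‖p.2‖ ∧ ‖p.2‖ < K} (fun p => 1 - g p.1 p.2) p :=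
      (measurable_const.sub hg).indicator
        ((measurableSet_lt measurable_fst.norm measurable_snd.norm).inter
          (measurableSet_lt measurable_snd.norm measurable_const))
    exact (hm.stronglyMeasurable.integral_prod_right' (ν := volume)).measurable
  have hr : Tendsto (fun K : ℕ => ∫ x in ball (0 : Plane) K,
      lam * Real.exp (-(lam * (Real.pi * ‖x‖ ^ 2))) *
        Real.exp (-(lam * ∫ y in {y : Plane | ‖x‖ < ‖y‖ ∧ ‖y‖ < K}, (1 - g x y)))) atTop
      (𝓝 (∫ x : Plane, lam * Real.exp (-(lam * (Real.pi * ‖x‖ ^ 2))) *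
          Real.exp (-(lam * ∫ y in {y : Plane | ‖x‖ < ‖y‖}, (1 - g x y))))) := by
    simp_rw [fun K : ℕ => (integral_indicator (measurableSet_ball (x := (0 : Plane)) (ε := K))
      (f := fun x : Plane => lam * Real.exp (-(lam * (Real.pi * ‖x‖ ^ 2))) *
        Real.exp (-(lam * ∫ y in {y : Plane | ‖x‖ < ‖y‖ ∧ ‖y‖ < K}, (1 - g x y))))
      (μ := volume)).symm]
    refine tendsto_integral_of_dominated_convergence
      (fun x => lam * Real.exp (-(lam * (Real.pi * ‖x‖ ^ 2)))) (fun K => ?_)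
      (integrable_exp_neg_pi_mul_sq_norm (NNReal.coe_pos.2 hlam)) (fun K => ?_) ?_
    · refine (Measurable.indicator (Measurable.mul (by fun_prop) ?_)
        measurableSet_ball).aestronglyMeasurable
      exact Real.measurable_exp.comp ((hIm K).const_mul _).neg
    · filter_upwards with x
      refine (norm_indicator_le_norm_self _ _).trans ?_
      rw [Real.norm_of_nonneg (by positivity)]
      refine mul_le_of_le_one_right (by positivity) (Real.exp_le_one_iff.2 (neg_nonpos.2 ?_))
      exact mul_nonneg lam.coe_nonneg (integral_nonneg fun y => sub_nonneg.2 (hg1 x y))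
    · filter_upwards with x
      have hi : Tendsto (fun K : ℕ => ∫ y in {y : Plane | ‖x‖ < ‖y‖ ∧ ‖y‖ < K}, (1 - g x y)) atTop
          (𝓝 (∫ y in {y : Plane | ‖x‖ < ‖y‖}, (1 - g x y))) := by
        have hU : {y : Plane | ‖x‖ < ‖y‖} = ⋃ K : ℕ, {y : Plane | ‖x‖ < ‖y‖ ∧ ‖y‖ < K} := by
          ext y
          simp only [mem_ofPred_eq, mem_iUnion, exists_and_left]
          exact ⟨fun hy => ⟨hy, exists_nat_gt _⟩, fun hy => hy.1⟩
        have hgi' := hgi x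
        rw [hU] at hgi' ⊢
        exact tendsto_setIntegral_of_monotone (hSK x)
          (fun m n hmn y hy => ⟨hy.1, hy.2.trans_le (by exact_mod_cast hmn)⟩) hgi'
      refine (((Real.continuous_exp.tendsto _).comp ((hi.const_mul _).neg)).const_mul _).congr' ?_
      obtain ⟨N, hN⟩ := exists_nat_gt ‖x‖
      filter_upwards [eventually_ge_atTop N] with K hK
      rw [indicator_of_mem (mem_ball_zero_iff.2 (hN.trans_le (by exact_mod_cast hK)))]
      rfl
  refine tendsto_nhds_unique hl (hr.congr fun K => ?_)
  exact (h.integral_nearest_truncated hs K hgx hgabs hgc).symm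

end IsHomogeneousPPP

/-! ### Laplace transforms of the fading variables. -/

theorem measurable_gammaPDF (a r : ℝ) : Measurable (gammaPDF a r) :=
  (measurable_gammaPDFReal a r).ennreal_ofReal

theorem ae_pos_gammaMeasure (a r : ℝ) : ∀ᵐ x ∂gammaMeasure a r, 0 < x := by
  rw [gammaMeasure, ae_withDensity_iff (measurable_gammaPDF a r)]
  filter_upwards [Measure.ae_ne volume 0] with x hx0 hx
  by_contra hneg
  exact hx (gammaPDF_of_neg (lt_of_le_of_ne (not_lt.1 hneg) hx0))

theorem integral_exp_neg_mul_gammaMeasure {a t : ℝ} (ha : 0 < a) (ht : 0 ≤ t) :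
    ∫ x, Real.exp (-(t * x)) ∂gammaMeasure a 1 = 1 / (1 + t) ^ a := by
  rw [gammaMeasure, integral_withDensity_eq_integral_toReal_smul
    (measurable_gammaPDF a 1) (ae_of_all _ fun _ => ENNReal.ofReal_lt_top)]
  have h1 : ∀ x : ℝ, (gammaPDF a 1 x).toReal • Real.exp (-(t * x)) =
      indicator (Ici 0) (fun x => (Real.Gamma a)⁻¹ *
        (x ^ (a - 1) * Real.exp (-((1 + t) * x)))) x := by
    intro x
    rw [gammaPDF, ENNReal.toReal_ofReal (gammaPDFReal_nonneg ha one_pos x), gammaPDFReal]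
    by_cases hx : 0 ≤ x
    · rw [indicator_of_mem (mem_Ici.2 hx), if_pos hx, smul_eq_mul, Real.one_rpow,
        show -((1 + t) * x) = -(1 * x) + -(t * x) by ring, Real.exp_add]
      ring
    · rw [indicator_of_notMem (by simpa using hx), if_neg hx, zero_smul]
  simp_rw [h1]
  rw [integral_indicator measurableSet_Ici, integral_Ici_eq_integral_Ioi, integral_const_mul,
    Real.integral_rpow_mul_exp_neg_mul_Ioi ha (by linarith), Real.div_rpow zero_le_one
      (by linarith), Real.one_rpow, mul_comm, mul_assoc,
    mul_inv_cancel₀ (Real.Gamma_pos_of_pos ha).ne', mul_one]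

/-- The absolute value is invisible almost surely, but it keeps the exponential bounded by 1
everywhere, which later supplies integrability and domination. -/
theorem integral_exp_neg_mul_abs_gammaMeasure {a t : ℝ} (ha : 0 < a) (ht : 0 ≤ t) :
    ∫ x, Real.exp (-(t * |x|)) ∂gammaMeasure a 1 = 1 / (1 + t) ^ a := by
  rw [← integral_exp_neg_mul_gammaMeasure ha ht]
  refine integral_congr_ae ?_
  filter_upwards [ae_pos_gammaMeasure a 1] with x hx
  rw [abs_of_pos hx]

/-- Integrating out independent exponential fading given the positions `X`. -/
theorem integral_mul_prod_exp_fading {Ω α : Type*} [MeasurableSpace Ω] [MeasurableSpace α]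
    {μ : Measure Ω} [IsProbabilityMeasure μ] {X : Ω → α} (hX : Measurable X) {f : ℕ → Ω → ℝ}
    (hf : ∀ i, Measurable (f i)) (hfi : iIndepFun f μ) (hXf : IndepFun X (fun ω i => f i ω) μ)
    (hlaw : ∀ k, μ.map (f (k + 1)) = expMeasure 1) {φ : ℝ → ℝ} (hφ : Measurable φ)
    (hφ1 : ∀ x, |φ x| ≤ 1) {a : ℕ → α → ℝ} (ha : ∀ k, Measurable (a k)) (ha0 : ∀ k x, 0 ≤ a k x)
    (n : ℕ) :
    ∫ ω, φ (f 0 ω) * ∏ k ∈ Finset.range n, Real.exp (-(a k (X ω) * |f (k + 1) ω|)) ∂μ =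
      (∫ ω, φ (f 0 ω) ∂μ) * ∫ ω, ∏ k ∈ Finset.range n, 1 / (1 + a k (X ω)) ∂μ := by
  have hfm : Measurable fun ω i => f i ω := measurable_pi_lambda _ hf
  have hprod := (indepFun_iff_map_prod_eq_prod_map_map hX.aemeasurable hfm.aemeasurable).1 hXf
  have hPX : IsProbabilityMeasure (μ.map X) := Measure.isProbabilityMeasure_map hX.aemeasurable
  have hPf : IsProbabilityMeasure (μ.map fun ω i => f i ω) :=
    Measure.isProbabilityMeasure_map hfm.aemeasurable
  set Φ : α × (ℕ → ℝ) → ℝ := fun p =>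
    φ (p.2 0) * ∏ k ∈ Finset.range n, Real.exp (-(a k p.1 * |p.2 (k + 1)|)) with hΦ
  have hΦm : Measurable Φ := by
    refine (hφ.comp ((measurable_pi_apply 0).comp measurable_snd)).mul
      (Finset.measurable_fun_prod _ fun k _ => Real.measurable_exp.comp (Measurable.neg ?_))
    exact ((ha k).comp measurable_fst).mul
      (((measurable_pi_apply (k + 1)).comp measurable_snd).abs)
  have hΦ1 : ∀ p, ‖Φ p‖ ≤ 1 := by
    intro p
    rw [hΦ, norm_mul, norm_prod]
    refine mul_le_one₀ (hφ1 _) (Finset.prod_nonneg fun _ _ => norm_nonneg _)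
      (Finset.prod_le_one (fun _ _ => norm_nonneg _) fun k _ => ?_)
    rw [Real.norm_of_nonneg (Real.exp_pos _).le]
    exact Real.exp_le_one_iff.2 (neg_nonpos.2 (mul_nonneg (ha0 _ _) (abs_nonneg _)))
  have hint : Integrable Φ ((μ.map X).prod (μ.map fun ω i => f i ω)) :=
    Integrable.of_bound hΦm.aestronglyMeasurable 1 (ae_of_all _ hΦ1)
  have h1 : ∫ ω, φ (f 0 ω) * ∏ k ∈ Finset.range n, Real.exp (-(a k (X ω) * |f (k + 1) ω|)) ∂μ =
      ∫ p, Φ p ∂((μ.map X).prod (μ.map fun ω i => f i ω)) := by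
    rw [← hprod, integral_map (hX.prodMk hfm).aemeasurable hΦm.aestronglyMeasurable]
  rw [h1, integral_prod _ hint]
  -- The joint law is a product measure, so the positions can be frozen at `δ` and the independent
  -- fading variables integrated one by one.
  have h2 : ∀ δ : α, ∫ y, Φ (δ, y) ∂(μ.map fun ω i => f i ω) =
      (∫ ω, φ (f 0 ω) ∂μ) * ∏ k ∈ Finset.range n, 1 / (1 + a k δ) := by
    intro δ
    rw [integral_map (f := fun y => Φ (δ, y)) hfm.aemeasurable
      (hΦm.comp measurable_prodMk_left).aestronglyMeasurable]
    have hind : iIndepFun (fun i : Fin (n + 1) => f i) μ := hfi.precomp Fin.val_injective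
    let ψ : Fin (n + 1) → ℝ → ℝ :=
      Fin.cons φ fun k : Fin n => fun x => Real.exp (-(a k δ * |x|))
    have hψ : ∀ i, Measurable (ψ i) := by
      intro i
      refine Fin.cases hφ (fun k => ?_) i
      change Measurable fun x => Real.exp (-(a k δ * |x|))
      fun_prop
    have key := hind.integral_fun_prod_comp (𝕜 := ℝ) (f := ψ) (fun i => (hf i).aemeasurable)
      (fun i => (hψ i).aestronglyMeasurable)
    simp only [Fin.prod_univ_succ] at key
    have h3 : ∀ k : Fin n, ∫ ω, ψ k.succ (f (k.succ : Fin (n + 1)) ω) ∂μ = 1 / (1 + a k δ) := by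
      intro k
      change ∫ ω, Real.exp (-(a k δ * |f (k + 1) ω|)) ∂μ = _
      rw [← integral_map (f := fun x => Real.exp (-(a k δ * |x|))) (hf _).aemeasurable
        (by fun_prop), hlaw, expMeasure, integral_exp_neg_mul_abs_gammaMeasure one_pos (ha0 _ _),
        Real.rpow_one]
    simp_rw [h3] at key
    rw [Finset.prod_range]
    refine Eq.trans ?_ key
    refine integral_congr_ae (ae_of_all _ fun ω => ?_)
    simp only [hΦ, Finset.prod_range]
    rfl
  simp_rw [h2]
  rw [integral_const_mul, integral_map hX.aemeasurable]
  refine (Finset.measurable_fun_prod _ fun k _ => ?_).aestronglyMeasurable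
  exact measurable_const.div (measurable_const.add (ha k))

/-! ### Laplace transform of the interference. -/

/-- The limit of `exp (-(z * ∑ k < n, u k))`. -/
noncomputable def expNegSum (z : ℝ) (u : ℕ → ℝ) : ℝ :=
  open Classical in if Summable u then Real.exp (-(z * ∑' k, u k)) else 0

/-- For divergent nonnegative series the partial sums tend to infinity, hence the value 0; the
convention for `tsum` would give 1 there. The Laplace transform can thus be computed before the
interference is known to converge. -/
theorem tendsto_prod_exp_neg {z : ℝ} (hz : 0 < z) {u : ℕ → ℝ} (hu : ∀ k, 0 ≤ u k) :
    Tendsto (fun n => ∏ k ∈ Finset.range n, Real.exp (-(z * u k))) atTop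
      (𝓝 (expNegSum z u)) := by
  simp_rw [← Real.exp_sum, Finset.sum_neg_distrib, ← Finset.mul_sum]
  rw [expNegSum]
  split_ifs with h
  · exact (Real.continuous_exp.tendsto _).comp ((h.hasSum.tendsto_sum_nat.const_mul z).neg)
  · exact Real.tendsto_exp_neg_atTop_nhds_zero.comp
      (((not_summable_iff_tendsto_nat_atTop_of_nonneg hu).1 h).const_mul_atTop hz)

theorem exists_tendsto_prod {c : ℕ → ℝ} (h0 : ∀ k, 0 ≤ c k) (h1 : ∀ k, c k ≤ 1) :
    ∃ L, Tendsto (fun n => ∏ k ∈ Finset.range n, c k) atTop (𝓝 L) :=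
  ⟨_, tendsto_atTop_ciInf (fun m n hmn => prod_le_prod_of_subset_of_le_one
    (Finset.range_subset_range.2 hmn) h0 h1)
    ⟨0, by rintro _ ⟨n, rfl⟩; exact Finset.prod_nonneg fun k _ => h0 k⟩⟩

/-- The success factor at a receiver `x` due to an interferer `y`, with exponential fading. -/
noncomputable def fadingFactor (β p : ℝ) (x y : Plane) : ℝ :=
  1 / (1 + p * ‖x‖ ^ (2 * β) * ‖x - y‖ ^ (-β))

section
variable {β p : ℝ}

theorem fadingFactor_nonneg (hp : 0 ≤ p) (x y : Plane) : 0 ≤ fadingFactor β p x y := by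
  unfold fadingFactor; positivity

theorem fadingFactor_le_one (hp : 0 ≤ p) (x y : Plane) : fadingFactor β p x y ≤ 1 := by
  unfold fadingFactor
  rw [div_le_one (by positivity)]
  have : 0 ≤ p * ‖x‖ ^ (2 * β) * ‖x - y‖ ^ (-β) := by positivity
  linarith

theorem measurable_fadingFactor : Measurable (Function.uncurry (fadingFactor β p)) := by
  unfold fadingFactor Function.uncurry
  fun_prop

theorem continuousAt_fadingFactor (hβ : 0 < β) (hp : 0 ≤ p) {x y : Plane} (hxy : ‖x‖ < ‖y‖) :
    ContinuousAt (fun x => fadingFactor β p x y) x := by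
  unfold fadingFactor
  have hne : ‖x - y‖ ≠ 0 := norm_ne_zero_iff.2 (sub_ne_zero.2 fun h => by simp [h] at hxy)
  refine continuousAt_const.div (continuousAt_const.add ?_) (by positivity)
  refine (continuousAt_const.mul ?_).mul ?_
  · exact continuous_norm.continuousAt.rpow_const (Or.inr (by positivity))
  · exact (continuousAt_id.sub continuousAt_const).norm.rpow_const (Or.inl hne)

end

/-- The Laplace transform of the normalized interference, as an integral over the position of the
nearest base station. -/
noncomputable def laplaceInterference (lam β p : ℝ) : ℝ :=
  ∫ x : Plane, lam * Real.exp (-(lam * (Real.pi * ‖x‖ ^ 2))) *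
    Real.exp (-(lam * ∫ y in {y : Plane | ‖x‖ < ‖y‖}, (1 - fadingFactor β p x y)))

section
variable {Ω : Type*}

/-- The power received from an interferer, normalized by the round-trip path loss. -/
noncomputable def normalizedTerm (β pt : ℝ) (d : ℕ → Ω → Plane) (f : ℕ → Ω → ℝ) (ω : Ω)
    (k : ℕ) : ℝ :=
  ‖d 0 ω‖ ^ (2 * β) * interferenceTerm β pt 1 d f k ω

variable [MeasurableSpace Ω] {μ : Measure Ω} {lam : ℝ≥0} {Mt : ℕ}
  {d : ℕ → Ω → Plane} {f : ℕ → Ω → ℝ}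

theorem IsSensingNetwork.ae_fading_pos (h : IsSensingNetwork μ lam Mt 1 d f) :
    ∀ᵐ ω ∂μ, ∀ i, 0 < f i ω := by
  refine ae_all_iff.2 fun i => ?_
  have h1 : ∀ᵐ x ∂(μ.map (f i)), 0 < x := by
    rcases Nat.eq_zero_or_pos i with rfl | hi
    · rw [h.law_sensing 0 one_pos]
      exact ae_pos_gammaMeasure _ _
    · rw [h.law_interfering i hi]
      exact ae_pos_gammaMeasure _ _
  exact ae_of_ae_map (h.measurable_fading i).aemeasurable h1

variable [IsProbabilityMeasure μ]

/-- For finitely many interferers the fading integrates out and the signal factor `φ (f 0)` splits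
off by independence. Letting the number of interferers grow, the remaining mean is the generating
functional of the points beyond the nearest one. -/
theorem IsSensingNetwork.integral_mul_expNegSum (h : IsSensingNetwork μ lam Mt 1 d f)
    (hlam : 0 < lam) {β pt z : ℝ} (hβ : 0 < β) (hpt : 0 < pt) (hz : 0 < z)
    (hint : ∀ x : Plane, IntegrableOn (fun y => 1 - fadingFactor β (z * pt) x y)
      {y : Plane | ‖x‖ < ‖y‖})
    {φ : ℝ → ℝ} (hφ : Measurable φ) (hφ1 : ∀ x, |φ x| ≤ 1) :
    AEMeasurable (fun ω => expNegSum z (normalizedTerm β pt d f ω)) μ ∧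
    ∫ ω, φ (f 0 ω) * expNegSum z (normalizedTerm β pt d f ω) ∂μ =
      (∫ ω, φ (f 0 ω) ∂μ) * laplaceInterference lam β (z * pt) := by
  have hzp : 0 ≤ z * pt := by positivity
  have hX : Measurable fun ω i => d i ω := measurable_pi_lambda _ h.ppp.measurable_point
  obtain ⟨a, ha_def⟩ : ∃ a : ℕ → (ℕ → Plane) → ℝ, a = fun k δ =>
    z * pt * ‖δ 0‖ ^ (2 * β) * ‖δ 0 - δ (k + 1)‖ ^ (-β) := ⟨_, rfl⟩
  have ha : ∀ k, Measurable (a k) := fun k => by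
    simp only [ha_def]
    fun_prop
  have ha0 : ∀ k δ, 0 ≤ a k δ := fun k δ => by simp only [ha_def]; positivity
  have hn := integral_mul_prod_exp_fading hX h.measurable_fading h.indep_fading
    h.indep_positions (fun k => h.law_interfering (k + 1) (by omega)) hφ hφ1 ha ha0
  have hPm : ∀ n, Measurable fun ω =>
      ∏ k ∈ Finset.range n, Real.exp (-(a k (fun i => d i ω) * |f (k + 1) ω|)) := fun n =>
    Finset.measurable_fun_prod _ fun k _ => Real.measurable_exp.comp
      (((ha k).comp hX).mul (h.measurable_fading _).abs).neg
  have hP1 : ∀ n ω,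
      |∏ k ∈ Finset.range n, Real.exp (-(a k (fun i => d i ω) * |f (k + 1) ω|))| ≤ 1 := by
    intro n ω
    rw [Finset.abs_prod]
    refine Finset.prod_le_one (fun _ _ => abs_nonneg _) fun k _ => ?_
    rw [abs_of_pos (Real.exp_pos _)]
    exact Real.exp_le_one_iff.2 (neg_nonpos.2
      (mul_nonneg (ha0 k fun i => d i ω) (abs_nonneg _)))
  have hlim : ∀ᵐ ω ∂μ, Tendsto (fun n =>
      ∏ k ∈ Finset.range n, Real.exp (-(a k (fun i => d i ω) * |f (k + 1) ω|))) atTop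
      (𝓝 (expNegSum z (normalizedTerm β pt d f ω))) := by
    filter_upwards [h.ae_fading_pos] with ω hω
    have := tendsto_prod_exp_neg hz (u := normalizedTerm β pt d f ω) (fun k => by
      have := hω (1 + k)
      unfold normalizedTerm interferenceTerm
      positivity)
    refine this.congr fun n => Finset.prod_congr rfl fun k _ => ?_
    rw [abs_of_pos (hω _), normalizedTerm, interferenceTerm, add_comm 1 k]
    congr 2
    simp only [ha_def]
    ring
  have hmeas : AEMeasurable (fun ω => expNegSum z (normalizedTerm β pt d f ω)) μ :=
    aemeasurable_of_tendsto_metrizable_ae atTop (fun n => (hPm n).aemeasurable) hlim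
  refine ⟨hmeas, ?_⟩
  have hl : Tendsto (fun n => ∫ ω, φ (f 0 ω) *
      ∏ k ∈ Finset.range n, Real.exp (-(a k (fun i => d i ω) * |f (k + 1) ω|)) ∂μ) atTop
      (𝓝 (∫ ω, φ (f 0 ω) * expNegSum z (normalizedTerm β pt d f ω) ∂μ)) := by
    refine tendsto_integral_of_dominated_convergence (fun _ => 1) (fun n =>
      ((hφ.comp (h.measurable_fading 0)).mul (hPm n)).aestronglyMeasurable)
      (integrable_const _) (fun n => ae_of_all _ fun ω => ?_) ?_
    · rw [norm_mul]
      exact mul_le_one₀ (hφ1 _) (norm_nonneg _) (hP1 n ω)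
    · filter_upwards [hlim] with ω hω
      exact hω.const_mul _
  -- The partial products decrease in [0, 1], so the limit exists for every ω, even when it is 0.
  have hex : ∀ ω, ∃ L, Tendsto (fun n =>
      ∏ k ∈ Finset.range n, 1 / (1 + a k (fun i => d i ω))) atTop (𝓝 L) := fun ω =>
    exists_tendsto_prod (fun k => by have := ha0 k fun i => d i ω; positivity)
      (fun k => by
        have := ha0 k fun i => d i ω
        rw [div_le_one (by positivity)]
        linarith)
  choose L hL using hex
  have hfac : ∀ ω k, 1 / (1 + a k fun i => d i ω) =
      fadingFactor β (z * pt) (d 0 ω) (d (k + 1) ω) := fun ω k => by rw [ha_def]; rfl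
  have hLint := h.ppp.integral_nearest hlam h.sorted (measurable_fadingFactor (β := β))
    (fadingFactor_nonneg hzp) (fadingFactor_le_one hzp)
    (fun x y hxy => continuousAt_fadingFactor hβ hzp hxy) hint (L := L)
    (ae_of_all _ fun ω => (hL ω).congr fun n => Finset.prod_congr rfl fun k _ => hfac ω k)
  have hr : Tendsto (fun n => ∫ ω, ∏ k ∈ Finset.range n, 1 / (1 + a k (fun i => d i ω)) ∂μ) atTop
      (𝓝 (∫ ω, L ω ∂μ)) := by
    refine tendsto_integral_of_dominated_convergence (fun _ => 1) (fun n =>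
      (Finset.measurable_fun_prod _ fun k _ => measurable_const.div
        (measurable_const.add ((ha k).comp hX))).aestronglyMeasurable)
      (integrable_const _) (fun n => ae_of_all _ fun ω => ?_) (ae_of_all _ hL)
    rw [Real.norm_eq_abs, Finset.abs_prod]
    refine Finset.prod_le_one (fun _ _ => abs_nonneg _) fun k _ => ?_
    have := ha0 k fun i => d i ω
    rw [abs_of_nonneg (by positivity), div_le_one (by positivity)]
    linarith
  refine tendsto_nhds_unique hl ?_
  rw [laplaceInterference, ← hLint]
  exact (hr.const_mul _).congr fun n => (hn n).symm

end

/-! ### Radial integrals of the path loss and the geometry of the hole. -/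

/-- The probability `c t⁻ᵝ / (1 + c t⁻ᵝ)`, as a function of the distance `t`. -/
noncomputable def pathLoss (β c t : ℝ) : ℝ := c * t ^ (-β) / (1 + c * t ^ (-β))

section
variable {β c : ℝ}

theorem pathLoss_nonneg (hc : 0 ≤ c) {t : ℝ} (ht : 0 ≤ t) : 0 ≤ pathLoss β c t := by
  unfold pathLoss; positivity

theorem pathLoss_le_one (hc : 0 ≤ c) {t : ℝ} (ht : 0 ≤ t) : pathLoss β c t ≤ 1 := by
  unfold pathLoss
  have : 0 ≤ c * t ^ (-β) := by positivity
  rw [div_le_one (by positivity)]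
  linarith

theorem pathLoss_le (hc : 0 ≤ c) {t : ℝ} (ht : 0 ≤ t) : pathLoss β c t ≤ c * t ^ (-β) := by
  unfold pathLoss
  have : 0 ≤ c * t ^ (-β) := by positivity
  exact div_le_self this (by linarith)

theorem measurable_pathLoss : Measurable (Function.uncurry (pathLoss β)) := by
  unfold pathLoss Function.uncurry
  fun_prop

theorem one_sub_fadingFactor {p : ℝ} (hp : 0 ≤ p) (x y : Plane) :
    1 - fadingFactor β p x y = pathLoss β (p * ‖x‖ ^ (2 * β)) ‖x - y‖ := by
  unfold fadingFactor pathLoss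
  have : 1 + p * ‖x‖ ^ (2 * β) * ‖x - y‖ ^ (-β) ≠ 0 := by positivity
  field_simp
  ring

/-- The bound `pathLoss ≤ 1` serves near 0, and the bound c t^{-β} at infinity, where β > 2 makes
t^{1-β} integrable. -/
theorem integrableOn_mul_pathLoss (hβ : 2 < β) (hc : 0 ≤ c) :
    IntegrableOn (fun t => t * pathLoss β c t) (Ioi 0) := by
  have hm : Measurable fun t => t * pathLoss β c t :=
    measurable_id.mul (measurable_pathLoss.comp measurable_prodMk_left)
  rw [← Ioc_union_Ioi_eq_Ioi zero_le_one]
  refine IntegrableOn.union ?_ ?_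
  · refine Integrable.of_bound hm.aestronglyMeasurable 1 ?_
    filter_upwards [ae_restrict_mem measurableSet_Ioc] with t ht
    rw [Real.norm_of_nonneg (mul_nonneg ht.1.le (pathLoss_nonneg hc ht.1.le))]
    exact mul_le_one₀ ht.2 (pathLoss_nonneg hc ht.1.le) (pathLoss_le_one hc ht.1.le)
  · refine ((integrableOn_Ioi_rpow_of_lt (a := 1 - β) (by linarith) one_pos).const_mul c).mono'
      hm.aestronglyMeasurable ?_
    filter_upwards [ae_restrict_mem measurableSet_Ioi] with t ht
    have ht0 : 0 < t := one_pos.trans ht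
    rw [Real.norm_of_nonneg (mul_nonneg ht0.le (pathLoss_nonneg hc ht0.le)), sub_eq_add_neg,
      Real.rpow_add ht0, Real.rpow_one]
    have := mul_le_mul_of_nonneg_left (pathLoss_le (β := β) hc ht0.le) ht0.le
    linarith

theorem image_div_one_sub_Ioo : (fun s : ℝ => s / (1 - s)) '' Ioo 0 1 = Ioi 0 := by
  ext u
  constructor
  · rintro ⟨s, hs, rfl⟩
    exact div_pos hs.1 (sub_pos.2 hs.2)
  · intro hu
    have hu' : 0 < u := hu
    refine ⟨u / (1 + u), ⟨by positivity, (div_lt_one (by positivity)).2 (by linarith)⟩, ?_⟩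
    have : 1 + u ≠ 0 := by positivity
    have h2 : 1 - u / (1 + u) = 1 / (1 + u) := by field_simp; ring
    simp only [h2]
    field_simp

/-- Substitution u = s/(1 - s), which maps (0, 1) onto (0, ∞). -/
theorem integral_rpow_div_one_add (a : ℝ) :
    ∫ u in Ioi (0 : ℝ), u ^ (a - 1) / (1 + u) = betaFn a (1 - a) := by
  have hder : ∀ s ∈ Ioo (0 : ℝ) 1, HasDerivWithinAt (fun s : ℝ => s / (1 - s))
      (1 / (1 - s) ^ 2) (Ioo 0 1) s := by
    intro s hs
    have h1 : (1 - s) ≠ 0 := (sub_pos.2 hs.2).ne'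
    have := ((hasDerivAt_id s).div ((hasDerivAt_id s).const_sub 1) h1).hasDerivWithinAt
      (s := Ioo 0 1)
    refine this.congr_deriv ?_
    simp
  have hinj : InjOn (fun s : ℝ => s / (1 - s)) (Ioo 0 1) := by
    intro s hs t ht hst
    have h1 : (1 - s) ≠ 0 := (sub_pos.2 hs.2).ne'
    have h2 : (1 - t) ≠ 0 := (sub_pos.2 ht.2).ne'
    have h3 : s / (1 - s) = t / (1 - t) := hst
    rw [div_eq_div_iff h1 h2] at h3
    linarith
  rw [← image_div_one_sub_Ioo, integral_image_eq_integral_abs_deriv_smul measurableSet_Ioo hder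
    hinj, betaFn, intervalIntegral.integral_of_le zero_le_one, integral_Ioc_eq_integral_Ioo]
  refine setIntegral_congr_fun measurableSet_Ioo fun s hs => ?_
  have h1 : 0 < 1 - s := sub_pos.2 hs.2
  have h2 : 1 + s / (1 - s) = (1 - s)⁻¹ := by field_simp; ring
  have h3 : (1 - s) ^ (a - 1) * (1 - s) ^ (1 - a - 1) * (1 - s) = 1 := by
    nth_rewrite 3 [← Real.rpow_one (1 - s)]
    rw [← Real.rpow_add h1, ← Real.rpow_add h1, show a - 1 + (1 - a - 1) + 1 = 0 by ring,
      Real.rpow_zero]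
  simp only [smul_eq_mul]
  rw [h2, abs_of_pos (by positivity), Real.div_rpow hs.1.le h1.le]
  have h4 : (1 - s) ^ (a - 1) ≠ 0 := (Real.rpow_pos_of_pos h1 _).ne'
  field_simp
  linear_combination (-(s ^ (a - 1))) * h3

theorem integral_mul_pathLoss (hβ : 0 < β) (hc : 0 < c) :
    ∫ t in Ioi (0 : ℝ), t * pathLoss β c t =
      c ^ (2 / β) * (1 / β) * betaFn (2 / β) (1 - 2 / β) := by
  -- `k` is what the integrand becomes under v = t^β; the rescaling v = c u then produces the Beta
  -- integral.
  set k : ℝ → ℝ := fun v => 1 / β * v ^ (2 / β - 1) / (v / c + 1) with hk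
  have h1 : ∫ t in Ioi (0 : ℝ), t * pathLoss β c t = ∫ v in Ioi (0 : ℝ), k v := by
    rw [← integral_comp_rpow_Ioi_of_pos (g := k) hβ]
    refine setIntegral_congr_fun measurableSet_Ioi fun t ht => ?_
    have ht0 : 0 < t := ht
    have e1 : (t ^ β) ^ (2 / β - 1) = t ^ (2 - β) := by
      rw [← Real.rpow_mul ht0.le]
      congr 1
      field_simp
    have e2 : t ^ (β - 1) * t ^ (2 - β) = t := by
      rw [← Real.rpow_add ht0]
      norm_num
    simp only [hk, smul_eq_mul, pathLoss]
    rw [e1, Real.rpow_neg ht0.le]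
    have hb : 0 < t ^ β := Real.rpow_pos_of_pos ht0 _
    have e3 : β * t ^ (β - 1) * (1 / β * t ^ (2 - β) / (t ^ β / c + 1)) =
        (t ^ (β - 1) * t ^ (2 - β)) / (t ^ β / c + 1) := by
      field_simp
    rw [e3, e2]
    field_simp
  have h2 := integral_comp_mul_left_Ioi' k 0 hc
  rw [mul_zero] at h2
  rw [h1, ← h2, ← integral_rpow_div_one_add, smul_eq_mul, ← integral_const_mul,
    ← integral_const_mul]
  refine setIntegral_congr_fun measurableSet_Ioi fun u hu => ?_
  have hu0 : 0 < u := hu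
  simp only [hk]
  rw [Real.mul_rpow hc.le hu0.le, Real.rpow_sub_one hc.ne']
  have : c * u / c = u := by field_simp
  rw [this, add_comm u 1]
  field_simp

theorem integrable_pathLoss_norm (hβ : 2 < β) (hc : 0 ≤ c) :
    Integrable fun y : Plane => pathLoss β c ‖y‖ := by
  rw [integrable_fun_norm_addHaar]
  simpa using integrableOn_mul_pathLoss hβ hc

theorem integral_norm_plane (g : ℝ → ℝ) :
    ∫ y : Plane, g ‖y‖ = 2 * Real.pi * ∫ t in Ioi (0 : ℝ), t * g t := by
  rw [integral_fun_norm_addHaar, volume_real_ball_plane zero_le_one]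
  simp
  ring

/-- The angular extent of the part of a circle centred on the boundary of a disk that lies in
the disk. -/
theorem volume_setOf_le_cos {s : ℝ} (hs : 0 < s) :
    volume (Ioo (-Real.pi) Real.pi ∩ {θ | s ≤ Real.cos θ}) =
      ENNReal.ofReal (2 * Real.arccos s) := by
  by_cases hs1 : s ≤ 1
  · have : Ioo (-Real.pi) Real.pi ∩ {θ | s ≤ Real.cos θ} =
        Icc (-Real.arccos s) (Real.arccos s) := by
      have hlt : Real.arccos s < Real.pi := by
        have := Real.arccos_lt_pi_div_two.2 hs
        linarith [Real.pi_pos]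
      have hiff : ∀ θ, |θ| ≤ Real.pi → (s ≤ Real.cos θ ↔ |θ| ≤ Real.arccos s) := by
        intro θ hθ
        have := Real.strictAntiOn_cos.le_iff_ge (a := Real.arccos s) (b := |θ|)
          ⟨Real.arccos_nonneg s, Real.arccos_le_pi s⟩ ⟨abs_nonneg θ, hθ⟩
        rw [← Real.cos_abs θ, ← this, Real.cos_arccos (by linarith) hs1]
      ext θ
      rw [mem_inter_iff, mem_Icc, ← abs_le]
      refine ⟨fun hθ => (hiff θ (abs_le.2 ⟨hθ.1.1.le, hθ.1.2.le⟩)).1 hθ.2, fun hθ => ?_⟩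
      exact ⟨abs_lt.1 (hθ.trans_lt hlt), (hiff θ (hθ.trans hlt.le)).2 hθ⟩
    rw [this, Real.volume_Icc]
    congr 1
    ring
  · have : Ioo (-Real.pi) Real.pi ∩ {θ | s ≤ Real.cos θ} = ∅ := by
      ext θ
      simp only [mem_inter_iff, mem_ofPred_eq, mem_empty_iff_false, iff_false, not_and, not_le]
      exact fun _ => (Real.cos_le_one θ).trans_lt (not_le.1 hs1)
    rw [this, Real.arccos_of_one_le (not_le.1 hs1).le]
    simp

/-- Rotating the nearest base station onto the positive real axis lets complex polar coordinates
measure angles from its direction. -/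
theorem exists_isometry_complex {x : Plane} (hx : x ≠ 0) :
    ∃ ψ : ℂ ≃ₗᵢ[ℝ] Plane, ψ (‖x‖ : ℂ) = x := by
  let e : ℂ ≃ₗᵢ[ℝ] Plane := Complex.orthonormalBasisOneI.repr
  have hrc : (‖x‖ : ℂ) ≠ 0 := by exact_mod_cast norm_ne_zero_iff.2 hx
  obtain ⟨a, ha⟩ : ∃ a : Circle, (a : ℂ) = e.symm x / (‖x‖ : ℂ) :=
    ⟨⟨e.symm x / (‖x‖ : ℂ), by simp [Submonoid.unitSphere, hx]⟩, rfl⟩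
  refine ⟨(rotation a).trans e, ?_⟩
  rw [LinearIsometryEquiv.trans_apply, rotation_apply, ha, div_mul_cancel₀ _ hrc,
    e.apply_symm_apply]

/-- Law of cosines: the squared distance is r² + ρ² - 2rρ cos θ, and the r² cancels. -/
theorem norm_sub_le_iff_le_cos {r ρ θ : ℝ} (hr : 0 < r) (hρ : 0 < ρ) :
    ‖(r : ℂ) - Complex.polarCoord.symm (ρ, θ)‖ ≤ r ↔ ρ / (2 * r) ≤ Real.cos θ := by
  have h1 : ‖(r : ℂ) - Complex.polarCoord.symm (ρ, θ)‖ ^ 2 =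
      r ^ 2 + (ρ ^ 2 - 2 * r * ρ * Real.cos θ) := by
    rw [Complex.sq_norm, Complex.normSq_apply, Complex.polarCoord_symm_apply]
    simp only [Complex.sub_re, Complex.sub_im,
      Complex.mul_re, Complex.mul_im, Complex.add_re, Complex.add_im, Complex.ofReal_re,
      Complex.ofReal_im, Complex.I_re, Complex.I_im]
    linear_combination ρ ^ 2 * Real.sin_sq_add_cos_sq θ
  rw [← sq_le_sq₀ (norm_nonneg _) hr.le, h1, div_le_iff₀ (by positivity)]
  constructor
  · intro h
    have : ρ * ρ ≤ ρ * (Real.cos θ * (2 * r)) := by nlinarith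
    exact le_of_mul_le_mul_left this hρ
  · intro h
    nlinarith

/-- Seen from the receiver `x`, through v = x - y, the hole is a disk whose boundary passes through
the new origin. In polar coordinates there, the circle of radius ρ meets it in an arc of angle 2
arccos(ρ/(2‖x‖)). -/
theorem lintegral_hole {x : Plane} (hx : x ≠ 0) {G : ℝ → ℝ≥0∞} (hG : Measurable G) :
    ∫⁻ y in {y : Plane | ‖y‖ ≤ ‖x‖}, G ‖x - y‖ =
      ∫⁻ ρ in Ioi (0 : ℝ), ENNReal.ofReal ρ * G ρ *
        ENNReal.ofReal (2 * Real.arccos (ρ / (2 * ‖x‖))) := by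
  have hr : 0 < ‖x‖ := norm_pos_iff.2 hx
  obtain ⟨ψ, hψ⟩ := exists_isometry_complex hx
  set r := ‖x‖ with hr_def
  let F : Plane → ℝ≥0∞ := fun v => indicator {v : Plane | ‖x - v‖ ≤ r} (fun v => G ‖v‖) v
  have hS : MeasurableSet {y : Plane | ‖y‖ ≤ r} := measurableSet_le measurable_norm measurable_const
  have h1 : ∫⁻ y in {y : Plane | ‖y‖ ≤ r}, G ‖x - y‖ = ∫⁻ v, F v := by
    rw [← lintegral_indicator hS, ← lintegral_sub_left_eq_self F x]
    refine lintegral_congr fun y => ?_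
    simp only [F, indicator, mem_ofPred_eq, sub_sub_cancel]
  have h2 : ∫⁻ v, F v = ∫⁻ z : ℂ,
      indicator {z : ℂ | ‖(r : ℂ) - z‖ ≤ r} (fun z => G ‖z‖) z := by
    rw [← ψ.measurePreserving.lintegral_comp_emb ψ.toHomeomorph.measurableEmbedding F]
    refine lintegral_congr fun z => ?_
    have : ‖x - ψ z‖ = ‖(r : ℂ) - z‖ := by
      rw [← ψ.norm_map ((r : ℂ) - z), map_sub, hψ]
    simp only [F, indicator, mem_ofPred_eq, this, ψ.norm_map]
  rw [h1, h2, ← Complex.lintegral_comp_polarCoord_symm]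
  have h3 : ∀ p ∈ polarCoord.target, ENNReal.ofReal p.1 •
      indicator {z : ℂ | ‖(r : ℂ) - z‖ ≤ r} (fun z => G ‖z‖) (Complex.polarCoord.symm p) =
      ENNReal.ofReal p.1 * G p.1 *
        indicator {p : ℝ × ℝ | p.1 / (2 * r) ≤ Real.cos p.2} 1 p := by
    rintro ⟨ρ, θ⟩ hp
    have hρ : 0 < ρ := hp.1
    have hn : ‖Complex.polarCoord.symm (ρ, θ)‖ = ρ := by
      rw [Complex.norm_polarCoord_symm, abs_of_pos hρ]
    have hiff := norm_sub_le_iff_le_cos (θ := θ) hr hρ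
    by_cases hc : ρ / (2 * r) ≤ Real.cos θ
    · rw [indicator_of_mem (s := {z : ℂ | ‖(r : ℂ) - z‖ ≤ r}) (hiff.2 hc),
        indicator_of_mem (s := {p : ℝ × ℝ | p.1 / (2 * r) ≤ Real.cos p.2}) hc, hn]
      simp
    · rw [indicator_of_notMem (s := {z : ℂ | ‖(r : ℂ) - z‖ ≤ r}) (fun h => hc (hiff.1 h)),
        indicator_of_notMem (s := {p : ℝ × ℝ | p.1 / (2 * r) ≤ Real.cos p.2}) hc]
      simp
  have hT : MeasurableSet {p : ℝ × ℝ | p.1 / (2 * r) ≤ Real.cos p.2} :=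
    measurableSet_le (by fun_prop) (by fun_prop)
  rw [setLIntegral_congr_fun polarCoord.open_target.measurableSet h3, polarCoord_target,
    Measure.volume_eq_prod, ← Measure.prod_restrict, lintegral_prod]
  · refine setLIntegral_congr_fun measurableSet_Ioi fun ρ hρ => ?_
    have hρ0 : 0 < ρ := hρ
    have hTρ : MeasurableSet {θ : ℝ | ρ / (2 * r) ≤ Real.cos θ} :=
      measurableSet_le measurable_const Real.measurable_cos
    have hind : ∀ θ, indicator {p : ℝ × ℝ | p.1 / (2 * r) ≤ Real.cos p.2} (1 : ℝ × ℝ → ℝ≥0∞)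
        (ρ, θ) = indicator {θ : ℝ | ρ / (2 * r) ≤ Real.cos θ} 1 θ := fun θ => rfl
    simp only [hind]
    rw [lintegral_const_mul _ (measurable_one.indicator hTρ), lintegral_indicator_one hTρ,
      Measure.restrict_apply hTρ, inter_comm, volume_setOf_le_cos (by positivity)]
  · exact (((ENNReal.measurable_ofReal.comp measurable_fst).mul (hG.comp measurable_fst)).mul
      (measurable_one.indicator hT)).aemeasurable

theorem integral_hole_eq_integral_Ioi {x : Plane} (hx : x ≠ 0) {g : ℝ → ℝ} (hg : Measurable g)
    (hg0 : ∀ t, 0 ≤ t → 0 ≤ g t) :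
    ∫ y in {y : Plane | ‖y‖ ≤ ‖x‖}, g ‖x - y‖ =
      ∫ ρ in Ioi (0 : ℝ), ρ * g ρ * (2 * Real.arccos (ρ / (2 * ‖x‖))) := by
  have hkm : Measurable fun ρ => ρ * g ρ * (2 * Real.arccos (ρ / (2 * ‖x‖))) := by
    have := Real.measurable_arccos
    fun_prop
  rw [integral_eq_lintegral_of_nonneg_ae (ae_of_all _ fun y => hg0 _ (norm_nonneg _))
    (hg.comp (measurable_const.sub measurable_id).norm).aestronglyMeasurable,
    lintegral_hole hx (G := fun t => ENNReal.ofReal (g t)) hg.ennreal_ofReal,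
    integral_eq_lintegral_of_nonneg_ae _ hkm.aestronglyMeasurable]
  · congr 1
    refine setLIntegral_congr_fun measurableSet_Ioi fun ρ hρ => ?_
    have hρ0 : 0 ≤ ρ := le_of_lt hρ
    rw [ENNReal.ofReal_mul (mul_nonneg hρ0 (hg0 ρ hρ0)), ENNReal.ofReal_mul hρ0]
  · filter_upwards [ae_restrict_mem measurableSet_Ioi] with ρ hρ
    have hρ0 : 0 ≤ ρ := le_of_lt hρ
    exact mul_nonneg (mul_nonneg hρ0 (hg0 ρ hρ0))
      (mul_nonneg zero_le_two (Real.arccos_nonneg _))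

/-- Scaling ρ = ‖x‖ t. The range stops at 2, the diameter of the hole in units of its radius, beyond
which `Real.arccos` is 0 by its clamping convention. -/
theorem integral_hole {x : Plane} (hx : x ≠ 0) {g : ℝ → ℝ} (hg : Measurable g)
    (hg0 : ∀ t, 0 ≤ t → 0 ≤ g t) :
    ∫ y in {y : Plane | ‖y‖ ≤ ‖x‖}, g ‖x - y‖ =
      ‖x‖ ^ 2 * ∫ t in (0 : ℝ)..2, 2 * Real.arccos (t / 2) * g (‖x‖ * t) * t := by
  have hr : 0 < ‖x‖ := norm_pos_iff.2 hx
  set k : ℝ → ℝ := fun ρ => ρ * g ρ * (2 * Real.arccos (ρ / (2 * ‖x‖))) with hk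
  have h1 : ∫ y in {y : Plane | ‖y‖ ≤ ‖x‖}, g ‖x - y‖ = ∫ ρ in Ioi (0 : ℝ), k ρ :=
    integral_hole_eq_integral_Ioi hx hg hg0
  have h2 := integral_comp_mul_left_Ioi' k 0 hr
  rw [mul_zero] at h2
  have h3 : ∀ t, k (‖x‖ * t) = ‖x‖ * (2 * Real.arccos (t / 2) * g (‖x‖ * t) * t) := by
    intro t
    simp only [hk]
    rw [show ‖x‖ * t / (2 * ‖x‖) = t / 2 by field_simp]
    ring
  simp_rw [h3] at h2
  rw [integral_const_mul, smul_eq_mul, ← mul_assoc, ← sq] at h2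
  rw [h1, ← h2, intervalIntegral.integral_of_le zero_le_two]
  congr 1
  refine setIntegral_eq_of_subset_of_forall_sdiff_eq_zero measurableSet_Ioi
    (fun t ht => ht.1) fun t ht => ?_
  have : 2 < t := by
    by_contra hle
    exact ht.2 ⟨ht.1, not_lt.1 hle⟩
  rw [Real.arccos_of_one_le (by linarith)]
  ring

end

/-! ### The exponent with the hole, its bounds, and the asymptotics of the Laplace transform. -/

/-- The logarithm of the Laplace functional of the interferers outside the hole, up to the factor
`-lam`, when the nearest base station is at `x`. -/
noncomputable def outsideExponent (β p : ℝ) (x : Plane) : ℝ :=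
  ∫ y in {y : Plane | ‖x‖ < ‖y‖}, (1 - fadingFactor β p x y)

/-- The exponent for interferers in the whole plane. -/
noncomputable def planeExponent (β p r : ℝ) : ℝ :=
  Real.pi * r ^ 4 * (2 / β) * p ^ (2 / β) * betaFn (2 / β) (1 - 2 / β)

section
variable {β p : ℝ}

theorem integrable_one_sub_fadingFactor (hβ : 2 < β) (hp : 0 ≤ p) (x : Plane) :
    Integrable fun y => 1 - fadingFactor β p x y := by
  simp_rw [one_sub_fadingFactor hp]
  exact (integrable_pathLoss_norm hβ (by positivity)).comp_sub_left x

theorem measurable_outsideExponent : Measurable (outsideExponent β p) := by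
  have hS : ∀ x : Plane, MeasurableSet {y : Plane | ‖x‖ < ‖y‖} := fun x =>
    measurableSet_lt measurable_const measurable_norm
  unfold outsideExponent
  simp_rw [fun x => (integral_indicator (hS x) (f := fun y => 1 - fadingFactor β p x y)
    (μ := volume)).symm]
  have hm : Measurable fun q : Plane × Plane =>
      indicator {q : Plane × Plane | ‖q.1‖ < ‖q.2‖} (fun q => 1 - fadingFactor β p q.1 q.2) q :=
    (measurable_const.sub measurable_fadingFactor).indicator
      (measurableSet_lt measurable_fst.norm measurable_snd.norm)
  exact (hm.stronglyMeasurable.integral_prod_right' (ν := volume)).measurable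

theorem outsideExponent_nonneg (hp : 0 ≤ p) (x : Plane) : 0 ≤ outsideExponent β p x :=
  integral_nonneg fun y => sub_nonneg.2 (fadingFactor_le_one hp x y)

/-- Translation centres the integral at the receiver; the power r⁴ arises as (r^{2β})^{2/β}. -/
theorem integral_one_sub_fadingFactor (hβ : 2 < β) (hp : 0 < p) {x : Plane} (hx : x ≠ 0) :
    ∫ y, (1 - fadingFactor β p x y) = planeExponent β p ‖x‖ := by
  have hr : 0 < ‖x‖ := norm_pos_iff.2 hx
  have hβ0 : β ≠ 0 := by linarith
  simp_rw [one_sub_fadingFactor hp.le]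
  rw [integral_sub_left_eq_self (fun v => pathLoss β (p * ‖x‖ ^ (2 * β)) ‖v‖),
    integral_norm_plane, integral_mul_pathLoss (by linarith) (by positivity),
    Real.mul_rpow hp.le (by positivity), ← Real.rpow_mul hr.le, planeExponent,
    show 2 * β * (2 / β) = (4 : ℕ) by field_simp; norm_num, Real.rpow_natCast]
  ring

theorem outsideExponent_add_hole (hβ : 2 < β) (hp : 0 < p) {x : Plane} (hx : x ≠ 0) :
    outsideExponent β p x + ∫ y in {y : Plane | ‖y‖ ≤ ‖x‖}, (1 - fadingFactor β p x y) =
      planeExponent β p ‖x‖ := by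
  rw [← integral_one_sub_fadingFactor hβ hp hx, outsideExponent]
  have hc : {y : Plane | ‖y‖ ≤ ‖x‖} = {y : Plane | ‖x‖ < ‖y‖}ᶜ := by
    ext y; simp
  rw [hc]
  exact integral_add_compl (measurableSet_lt measurable_const measurable_norm)
    (integrable_one_sub_fadingFactor hβ hp.le x)

theorem outsideExponent_eq (hβ : 2 < β) (hp : 0 < p) {x : Plane} (hx : x ≠ 0) :
    outsideExponent β p x = planeExponent β p ‖x‖ - ‖x‖ ^ 2 * ∫ t in (0 : ℝ)..2,
      2 * Real.arccos (t / 2) *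
        (p * ‖x‖ ^ β * t ^ (-β) / (1 + p * ‖x‖ ^ β * t ^ (-β))) * t := by
  have hr : 0 < ‖x‖ := norm_pos_iff.2 hx
  rw [← outsideExponent_add_hole hβ hp hx]
  simp_rw [one_sub_fadingFactor hp.le]
  have hc : 0 ≤ p * ‖x‖ ^ (2 * β) := by positivity
  rw [integral_hole hx (g := pathLoss β (p * ‖x‖ ^ (2 * β)))
    (measurable_pathLoss.comp measurable_prodMk_left) (fun t ht => pathLoss_nonneg hc ht),
    eq_sub_iff_add_eq]
  congr 2
  refine intervalIntegral.integral_congr fun t ht => ?_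
  rw [uIcc_of_le zero_le_two] at ht
  have h1 : p * ‖x‖ ^ (2 * β) * (‖x‖ * t) ^ (-β) = p * ‖x‖ ^ β * t ^ (-β) := by
    rw [Real.mul_rpow hr.le ht.1, mul_assoc, ← mul_assoc (‖x‖ ^ (2 * β)), ← Real.rpow_add hr,
      show 2 * β + -β = β by ring, mul_assoc]
  simp only [pathLoss, h1]

theorem outsideExponent_le (hβ : 2 < β) (hp : 0 < p) {x : Plane} (hx : x ≠ 0) :
    outsideExponent β p x ≤ planeExponent β p ‖x‖ := by
  rw [← outsideExponent_add_hole hβ hp hx]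
  exact le_add_of_nonneg_right
    (integral_nonneg fun y => sub_nonneg.2 (fadingFactor_le_one hp.le x y))

/-- The hole lies on one side of its tangent at the receiver, so each arc has angle 2 arccos(·) ≤ π
and the hole takes at most half of every circle. This lower bound gives the decay of the Laplace
transform. -/
theorem half_planeExponent_le (hβ : 2 < β) (hp : 0 < p) {x : Plane} (hx : x ≠ 0) :
    planeExponent β p ‖x‖ / 2 ≤ outsideExponent β p x := by
  have hr : 0 < ‖x‖ := norm_pos_iff.2 hx
  have hc : 0 ≤ p * ‖x‖ ^ (2 * β) := by positivity
  have h1 := outsideExponent_add_hole hβ hp hx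
  have h2 := integral_one_sub_fadingFactor hβ hp hx
  simp_rw [one_sub_fadingFactor hp.le] at h1 h2
  rw [integral_sub_left_eq_self (fun v => pathLoss β (p * ‖x‖ ^ (2 * β)) ‖v‖),
    integral_norm_plane] at h2
  rw [integral_hole_eq_integral_Ioi hx (g := pathLoss β (p * ‖x‖ ^ (2 * β)))
    (measurable_pathLoss.comp measurable_prodMk_left)
    (fun t ht => pathLoss_nonneg hc ht)] at h1
  have h3 : ∫ ρ in Ioi (0 : ℝ), ρ * pathLoss β (p * ‖x‖ ^ (2 * β)) ρ *
        (2 * Real.arccos (ρ / (2 * ‖x‖))) ≤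
      ∫ ρ in Ioi (0 : ℝ), ρ * pathLoss β (p * ‖x‖ ^ (2 * β)) ρ * Real.pi := by
    refine integral_mono_of_nonneg ?_ ((integrableOn_mul_pathLoss hβ hc).mul_const _) ?_
    · filter_upwards [ae_restrict_mem measurableSet_Ioi] with ρ hρ
      have hρ0 : 0 ≤ ρ := le_of_lt hρ
      exact mul_nonneg (mul_nonneg hρ0 (pathLoss_nonneg hc hρ0))
        (mul_nonneg zero_le_two (Real.arccos_nonneg _))
    · filter_upwards [ae_restrict_mem measurableSet_Ioi] with ρ hρ
      have hρ0 : 0 ≤ ρ := le_of_lt hρ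
      refine mul_le_mul_of_nonneg_left ?_ (mul_nonneg hρ0 (pathLoss_nonneg hc hρ0))
      have := Real.arccos_le_pi_div_two.2 (show 0 ≤ ρ / (2 * ‖x‖) by positivity)
      linarith
  rw [integral_mul_const] at h3
  linarith

/-- Read off from the Beta formula for the integral of a strictly positive function. -/
theorem betaFn_pos (hβ : 2 < β) : 0 < betaFn (2 / β) (1 - 2 / β) := by
  have h1 : 0 < ∫ t in Ioi (0 : ℝ), t * pathLoss β 1 t := by
    have hnn : ∀ t ∈ Ioi (0 : ℝ), 0 < t * pathLoss β 1 t := by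
      intro t ht
      have ht0 : 0 < t := ht
      unfold pathLoss
      positivity
    rw [setIntegral_pos_iff_support_of_nonneg_ae
      (by filter_upwards [ae_restrict_mem measurableSet_Ioi] with t ht using (hnn t ht).le)
      (integrableOn_mul_pathLoss hβ zero_le_one),
      inter_eq_right.2 fun t ht => Function.mem_support.2 (hnn t ht).ne']
    simp
  rw [integral_mul_pathLoss (by linarith) one_pos, Real.one_rpow, one_mul] at h1
  exact pos_of_mul_pos_right h1 (by positivity)

variable {lam : ℝ}

theorem laplaceInterference_eq (lam β p : ℝ) : laplaceInterference lam β p =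
    ∫ x : Plane, lam * Real.exp (-(lam * (Real.pi * ‖x‖ ^ 2))) *
      Real.exp (-(lam * outsideExponent β p x)) := rfl

theorem exp_neg_mul_outsideExponent_le_one (hlam : 0 < lam) (hp : 0 ≤ p) (x : Plane) :
    Real.exp (-(lam * outsideExponent β p x)) ≤ 1 :=
  Real.exp_le_one_iff.2 (neg_nonpos.2 (mul_nonneg hlam.le (outsideExponent_nonneg hp x)))

theorem measurable_laplaceIntegrand : Measurable fun x : Plane =>
    lam * Real.exp (-(lam * (Real.pi * ‖x‖ ^ 2))) *
      Real.exp (-(lam * outsideExponent β p x)) :=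
  Measurable.mul (by fun_prop) (Real.measurable_exp.comp
    ((measurable_outsideExponent (β := β) (p := p)).const_mul lam).neg)

theorem norm_laplaceIntegrand_le (hlam : 0 < lam) (hp : 0 ≤ p) (x : Plane) :
    ‖lam * Real.exp (-(lam * (Real.pi * ‖x‖ ^ 2))) *
      Real.exp (-(lam * outsideExponent β p x))‖ ≤
        lam * Real.exp (-(lam * (Real.pi * ‖x‖ ^ 2))) := by
  rw [Real.norm_of_nonneg (by positivity)]
  exact mul_le_of_le_one_right (by positivity) (exp_neg_mul_outsideExponent_le_one hlam hp x)

theorem integrable_laplaceIntegrand (hlam : 0 < lam) (hp : 0 ≤ p) : Integrable fun x : Plane =>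
    lam * Real.exp (-(lam * (Real.pi * ‖x‖ ^ 2))) *
      Real.exp (-(lam * outsideExponent β p x)) :=
  (integrable_exp_neg_pi_mul_sq_norm hlam).mono' measurable_laplaceIntegrand.aestronglyMeasurable
    (ae_of_all _ (norm_laplaceIntegrand_le hlam hp))

theorem laplaceInterference_nonneg (hlam : 0 < lam) : 0 ≤ laplaceInterference lam β p := by
  rw [laplaceInterference_eq]
  exact integral_nonneg fun x => by positivity

theorem laplaceInterference_le_one (hlam : 0 < lam) (hp : 0 ≤ p) :
    laplaceInterference lam β p ≤ 1 := by
  rw [laplaceInterference_eq, ← integral_exp_neg_pi_mul_sq_norm hlam]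
  exact integral_mono (integrable_laplaceIntegrand hlam hp)
    (integrable_exp_neg_pi_mul_sq_norm hlam)
    fun x => (le_abs_self _).trans (norm_laplaceIntegrand_le hlam hp x)

/-- The exponent is squeezed between 0 and the whole-plane exponent, which is of order p^{2/β}. This
limit is what proves that the interference is finite. -/
theorem tendsto_laplaceInterference (hlam : 0 < lam) (hβ : 2 < β) {q : ℕ → ℝ}
    (hq : ∀ n, 0 < q n) (hq0 : Tendsto q atTop (𝓝 0)) :
    Tendsto (fun n => laplaceInterference lam β (q n)) atTop (𝓝 1) := by
  simp_rw [laplaceInterference_eq]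
  rw [← integral_exp_neg_pi_mul_sq_norm hlam]
  refine tendsto_integral_of_dominated_convergence
    (fun x => lam * Real.exp (-(lam * (Real.pi * ‖x‖ ^ 2))))
    (fun n => measurable_laplaceIntegrand.aestronglyMeasurable)
    (integrable_exp_neg_pi_mul_sq_norm hlam)
    (fun n => ae_of_all _ (norm_laplaceIntegrand_le hlam (hq n).le)) ?_
  filter_upwards [Measure.ae_ne volume (0 : Plane)] with x hx
  have hβ0 : 0 < 2 / β := by have : 0 < β := by linarith
                             positivity
  have h1 : Tendsto (fun n => planeExponent β (q n) ‖x‖) atTop (𝓝 0) := by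
    have := ((hq0.rpow_const (p := 2 / β) (Or.inr hβ0.le)).const_mul
      (Real.pi * ‖x‖ ^ 4 * (2 / β))).mul_const (betaFn (2 / β) (1 - 2 / β))
    rw [Real.zero_rpow hβ0.ne', mul_zero, zero_mul] at this
    exact this
  have h2 : Tendsto (fun n => outsideExponent β (q n) x) atTop (𝓝 0) :=
    squeeze_zero (fun n => outsideExponent_nonneg (hq n).le x)
      (fun n => outsideExponent_le hβ (hq n) hx) h1
  have h3 := ((Real.continuous_exp.tendsto _).comp ((h2.const_mul lam).neg)).const_mul
    (lam * Real.exp (-(lam * (Real.pi * ‖x‖ ^ 2))))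
  simpa using h3

/-- Half of the whole-plane exponent is the square of a multiple of p^{1/β}‖x‖². Bounding the
exponential of this quartic by a Gaussian, whose integral over the plane is of order p^{-1/β}, gives
the decay that makes the outer integral converge at infinity. -/
theorem exists_laplaceInterference_le (hlam : 0 < lam) (hβ : 2 < β) :
    ∃ C, ∀ p, 0 < p → laplaceInterference lam β p ≤ C * p ^ (-(1 / β)) := by
  have hβ0 : 0 < β := by linarith
  -- Chosen so that λ times half of the whole-plane exponent equals (√κ p^{1/β} ‖x‖²)².
  set κ : ℝ := lam * (Real.pi * (1 / β) * betaFn (2 / β) (1 - 2 / β)) with hκ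
  have hκ0 : 0 < κ := by have := betaFn_pos hβ; positivity
  refine ⟨lam * Real.exp (1 / 4) * (Real.pi / √κ), fun p hp => ?_⟩
  have hq : 0 < p ^ (1 / β) := Real.rpow_pos_of_pos hp _
  have hb : 0 < √κ * p ^ (1 / β) := mul_pos (Real.sqrt_pos.2 hκ0) hq
  have hgi := GaussianFourier.integral_rexp_neg_mul_sq_norm (V := Plane) hb
  have hgint : Integrable fun x : Plane => Real.exp (-(√κ * p ^ (1 / β)) * ‖x‖ ^ 2) := by
    by_contra hn
    rw [integral_undef hn] at hgi
    exact (Real.rpow_pos_of_pos (by positivity) _).ne hgi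
  have hval : ∫ x : Plane, Real.exp (-(√κ * p ^ (1 / β)) * ‖x‖ ^ 2) =
      Real.pi / (√κ * p ^ (1 / β)) := by
    rw [hgi]
    simp
  have hbound : ∀ x : Plane, x ≠ 0 → lam * Real.exp (-(lam * (Real.pi * ‖x‖ ^ 2))) *
      Real.exp (-(lam * outsideExponent β p x)) ≤
      lam * Real.exp (1 / 4) * Real.exp (-(√κ * p ^ (1 / β)) * ‖x‖ ^ 2) := by
    intro x hx
    have h1 : lam * (planeExponent β p ‖x‖ / 2) = (√κ * p ^ (1 / β) * ‖x‖ ^ 2) ^ 2 := by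
      rw [mul_pow, mul_pow, Real.sq_sqrt hκ0.le, ← Real.rpow_natCast (p ^ (1 / β)),
        ← Real.rpow_mul hp.le, planeExponent, hκ]
      rw [show 1 / β * ((2 : ℕ) : ℝ) = 2 / β by push_cast; ring]
      ring
    have h2 := mul_le_mul_of_nonneg_left (half_planeExponent_le hβ hp hx) hlam.le
    rw [h1] at h2
    have h3 : Real.exp (-(lam * outsideExponent β p x)) ≤
        Real.exp (1 / 4) * Real.exp (-(√κ * p ^ (1 / β)) * ‖x‖ ^ 2) := by
      rw [← Real.exp_add]
      refine Real.exp_le_exp.2 ?_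
      -- From b² ≥ b - 1/4; this is the origin of the constant exp(1/4).
      nlinarith [sq_nonneg (√κ * p ^ (1 / β) * ‖x‖ ^ 2 - 1 / 2)]
    have h4 : Real.exp (-(lam * (Real.pi * ‖x‖ ^ 2))) ≤ 1 :=
      Real.exp_le_one_iff.2 (neg_nonpos.2 (by positivity))
    calc _ ≤ lam * 1 * (Real.exp (1 / 4) * Real.exp (-(√κ * p ^ (1 / β)) * ‖x‖ ^ 2)) :=
          mul_le_mul (mul_le_mul_of_nonneg_left h4 hlam.le) h3 (Real.exp_pos _).le (by positivity)
      _ = _ := by ring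
  rw [laplaceInterference_eq]
  calc _ ≤ ∫ x : Plane, lam * Real.exp (1 / 4) * Real.exp (-(√κ * p ^ (1 / β)) * ‖x‖ ^ 2) := by
        refine integral_mono_ae (integrable_laplaceIntegrand hlam hp.le) (hgint.const_mul _) ?_
        filter_upwards [Measure.ae_ne volume (0 : Plane)] with x hx using hbound x hx
    _ = _ := by
        rw [integral_const_mul, hval, Real.rpow_neg hp.le]
        field_simp

theorem exp_neg_mul_outsideExponent {lam β pt z : ℝ} (hβ : 2 < β) (hz : 0 < z * pt) {x : Plane}
    (hx : x ≠ 0) :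
    Real.exp (-(lam * outsideExponent β (z * pt) x)) =
      fullPlaneFactor lam β pt z ‖x‖ * holeFactor lam β pt z ‖x‖ := by
  rw [outsideExponent_eq hβ hz hx, fullPlaneFactor, holeFactor, ← Real.exp_add, planeExponent]
  congr 1
  ring

/-- Polar coordinates for the nearest point: the Jacobian 2πr turns its planar density into
`nearestDensity`. Integrability over r is inherited from that over the plane. -/
theorem integrableOn_distanceIntegrand {lam β pt z : ℝ} (hlam : 0 < lam) (hβ : 2 < β)
    (hz : 0 < z * pt) : IntegrableOn (fun r => distanceIntegrand lam β pt z r) (Ioi 0) ∧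
      laplaceInterference lam β (z * pt) = ∫ r in Ioi (0 : ℝ), distanceIntegrand lam β pt z r := by
  set g : ℝ → ℝ := fun r => lam * Real.exp (-(lam * (Real.pi * r ^ 2))) *
    (fullPlaneFactor lam β pt z r * holeFactor lam β pt z r) with hg
  have hae : (fun x : Plane => lam * Real.exp (-(lam * (Real.pi * ‖x‖ ^ 2))) *
      Real.exp (-(lam * outsideExponent β (z * pt) x))) =ᵐ[volume] fun x : Plane => g ‖x‖ := by
    filter_upwards [Measure.ae_ne volume (0 : Plane)] with x hx
    rw [exp_neg_mul_outsideExponent hβ hz hx]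
  have hrg : ∀ r, 2 * Real.pi * (r * g r) = distanceIntegrand lam β pt z r := by
    intro r
    simp only [hg, distanceIntegrand, nearestDensity]
    rw [show lam * (Real.pi * r ^ 2) = Real.pi * lam * r ^ 2 by ring]
    ring
  have hint : Integrable fun x : Plane => g ‖x‖ :=
    (integrable_laplaceIntegrand hlam hz.le).congr hae
  rw [integrable_fun_norm_addHaar] at hint
  simp only [finrank_euclideanSpace, Fintype.card_fin, Nat.add_one_sub_one, pow_one,
    smul_eq_mul] at hint
  constructor
  · simp_rw [← hrg]
    exact hint.const_mul _
  · rw [laplaceInterference_eq, integral_congr_ae hae, integral_norm_plane,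
      ← integral_const_mul]
    simp_rw [hrg]

end

/-! ### Frullani's integral and the mean of the logarithm. -/

theorem one_sub_exp_neg_mem_Icc {u : ℝ} (hu : 0 ≤ u) :
    0 ≤ 1 - Real.exp (-u) ∧ 1 - Real.exp (-u) ≤ 1 ∧ 1 - Real.exp (-u) ≤ u := by
  have h1 : Real.exp (-u) ≤ 1 := Real.exp_le_one_iff.2 (neg_nonpos.2 hu)
  have h2 := Real.exp_pos (-u)
  have h3 := Real.add_one_le_exp (-u)
  exact ⟨by linarith, by linarith, by linarith⟩

theorem integrableOn_frullani_exp {X Y : ℝ} (hX : 0 ≤ X) (hY : 0 < Y) :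
    IntegrableOn (fun z => 1 / z * ((1 - Real.exp (-(z * X))) * Real.exp (-(z * Y)))) (Ioi 0) := by
  refine ((integrableOn_exp_mul_Ioi (neg_lt_zero.2 hY) 0).const_mul X).mono'
    (Measurable.aestronglyMeasurable (by fun_prop)) ?_
  filter_upwards [ae_restrict_mem measurableSet_Ioi] with z hz
  have hz0 : 0 < z := hz
  obtain ⟨h1, -, h3⟩ := one_sub_exp_neg_mem_Icc (mul_nonneg hz0.le hX)
  rw [Real.norm_of_nonneg (by positivity), ← mul_assoc, show -Y * z = -(z * Y) by ring]
  refine mul_le_mul_of_nonneg_right ?_ (Real.exp_pos _).le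
  rw [one_div, inv_mul_le_iff₀ hz0]
  exact h3

/-- Frullani's formula for e^{-x} at the scales Y and X + Y. -/
theorem integral_frullani_exp {X Y : ℝ} (hX : 0 ≤ X) (hY : 0 < Y) :
    ∫ z in Ioi (0 : ℝ), 1 / z * ((1 - Real.exp (-(z * X))) * Real.exp (-(z * Y))) =
      Real.log (1 + X / Y) := by
  have hcont : Continuous fun x : ℝ => Real.exp (-x) := by fun_prop
  have heq : ∀ z : ℝ, z⁻¹ • (Real.exp (-(Y * z)) - Real.exp (-((X + Y) * z))) =
      1 / z * ((1 - Real.exp (-(z * X))) * Real.exp (-(z * Y))) := by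
    intro z
    rw [show -((X + Y) * z) = -(z * X) + -(z * Y) by ring, Real.exp_add, mul_comm Y z,
      smul_eq_mul, one_div]
    ring
  have hL : Tendsto (fun x : ℝ => Real.exp (-x)) (𝓝[>] 0) (𝓝 1) := by
    have := (hcont.tendsto 0).mono_left (nhdsWithin_le_nhds (s := Ioi 0))
    simpa using this
  have h := Frullani.integral_Ioi_eq (f := fun x : ℝ => Real.exp (-x)) (a := Y) (b := X + Y)
    (hcont.locallyIntegrable.locallyIntegrableOn _) hY (by linarith) hL
    Real.tendsto_exp_neg_atTop_nhds_zero (by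
      simp_rw [heq]
      exact integrableOn_frullani_exp hX hY)
  simp_rw [heq] at h
  rw [h, sub_zero, smul_eq_mul, mul_one]
  congr 1
  field_simp
  ring

/-- The ergodic rate in terms of the Laplace transforms of signal and interference. -/
theorem integrable_log_one_add_div {Ω : Type*} [MeasurableSpace Ω] {μ : Measure Ω}
    [IsProbabilityMeasure μ] {X Y : Ω → ℝ} (hX : Measurable X) (hX0 : ∀ ω, 0 ≤ X ω)
    (hY : AEMeasurable Y μ) (hY0 : ∀ᵐ ω ∂μ, 0 < Y ω) {D : ℝ → ℝ}
    (hD : ∀ z, 0 < z →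
      1 / z * ∫ ω, (1 - Real.exp (-(z * X ω))) * Real.exp (-(z * Y ω)) ∂μ = D z)
    (hDi : IntegrableOn D (Ioi 0)) :
    Integrable (fun ω => Real.log (1 + X ω / Y ω)) μ ∧
      ∫ ω, Real.log (1 + X ω / Y ω) ∂μ = ∫ z in Ioi (0 : ℝ), D z := by
  have hlogm : AEMeasurable (fun ω => Real.log (1 + X ω / Y ω)) μ :=
    Real.measurable_log.comp_aemeasurable ((hX.aemeasurable.div hY).const_add 1)
  have hlog0 : 0 ≤ᵐ[μ] fun ω => Real.log (1 + X ω / Y ω) := by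
    filter_upwards [hY0] with ω hω
    have := hX0 ω
    exact Real.log_nonneg (le_add_of_nonneg_right (by positivity))
  have hD0 : ∀ z, 0 < z → 0 ≤ D z := by
    intro z hz
    rw [← hD z hz]
    refine mul_nonneg (by positivity) (integral_nonneg fun ω => ?_)
    exact mul_nonneg (one_sub_exp_neg_mem_Icc (mul_nonneg hz.le (hX0 ω))).1 (Real.exp_pos _).le
  have hinner : ∀ z, 0 < z → ∫⁻ ω, ENNReal.ofReal
      (1 / z * ((1 - Real.exp (-(z * X ω))) * Real.exp (-(z * Y ω)))) ∂μ =
        ENNReal.ofReal (D z) := by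
    intro z hz
    rw [← hD z hz, ← integral_const_mul, ofReal_integral_eq_lintegral_ofReal]
    · refine Integrable.const_mul (Integrable.of_bound (AEMeasurable.aestronglyMeasurable ?_) 1 ?_)
        _
      · fun_prop
      · filter_upwards [hY0] with ω hω
        obtain ⟨h1, h2, -⟩ := one_sub_exp_neg_mem_Icc (mul_nonneg hz.le (hX0 ω))
        rw [norm_mul, Real.norm_of_nonneg h1, Real.norm_of_nonneg (Real.exp_pos _).le]
        exact mul_le_one₀ h2 (Real.exp_pos _).le
          (Real.exp_le_one_iff.2 (neg_nonpos.2 (by positivity)))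
    · refine ae_of_all _ fun ω => ?_
      have := (one_sub_exp_neg_mem_Icc (mul_nonneg hz.le (hX0 ω))).1
      change 0 ≤ 1 / z * ((1 - Real.exp (-(z * X ω))) * Real.exp (-(z * Y ω)))
      positivity
  -- The exchange of integrals takes place in [0, ∞], so integrability of the logarithm is a
  -- consequence of that of `D` rather than an assumption.
  have key : ∫⁻ ω, ENNReal.ofReal (Real.log (1 + X ω / Y ω)) ∂μ =
      ∫⁻ z in Ioi (0 : ℝ), ENNReal.ofReal (D z) := by
    have h1 : ∫⁻ ω, ENNReal.ofReal (Real.log (1 + X ω / Y ω)) ∂μ =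
        ∫⁻ ω, (∫⁻ z in Ioi (0 : ℝ), ENNReal.ofReal
          (1 / z * ((1 - Real.exp (-(z * X ω))) * Real.exp (-(z * Y ω))))) ∂μ := by
      refine lintegral_congr_ae ?_
      filter_upwards [hY0] with ω hω
      rw [← integral_frullani_exp (hX0 ω) hω,
        ofReal_integral_eq_lintegral_ofReal (integrableOn_frullani_exp (hX0 ω) hω)]
      filter_upwards [ae_restrict_mem measurableSet_Ioi] with z hz
      have hz0 : 0 < z := hz
      have := (one_sub_exp_neg_mem_Icc (mul_nonneg hz0.le (hX0 ω))).1
      change 0 ≤ 1 / z * ((1 - Real.exp (-(z * X ω))) * Real.exp (-(z * Y ω)))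
      positivity
    rw [h1, lintegral_lintegral_swap]
    · exact setLIntegral_congr_fun measurableSet_Ioi fun z hz => hinner z hz
    · have hY2 : AEMeasurable (fun q : Ω × ℝ => Y q.1) (μ.prod (volume.restrict (Ioi 0))) :=
        hY.comp_fst
      have hX2 : Measurable fun q : Ω × ℝ => X q.1 := hX.comp measurable_fst
      unfold Function.uncurry
      fun_prop
  have hDnn : 0 ≤ᵐ[volume.restrict (Ioi 0)] D := by
    filter_upwards [ae_restrict_mem measurableSet_Ioi] with z hz using hD0 z hz
  constructor
  · refine ⟨hlogm.aestronglyMeasurable, ?_⟩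
    rw [hasFiniteIntegral_iff_ofReal hlog0, key, ← hasFiniteIntegral_iff_ofReal hDnn]
    exact hDi.2
  · rw [integral_eq_lintegral_of_nonneg_ae hlog0 hlogm.aestronglyMeasurable, key,
      integral_eq_lintegral_of_nonneg_ae hDnn hDi.1]

theorem one_sub_one_div_pow_mem {u : ℝ} (hu : 0 ≤ u) (m : ℕ) :
    0 ≤ 1 - 1 / (1 + u) ^ m ∧ 1 - 1 / (1 + u) ^ m ≤ 1 ∧ 1 - 1 / (1 + u) ^ m ≤ m * u := by
  have h0 : (1 : ℝ) ≤ (1 + u) ^ m := one_le_pow₀ (by linarith)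
  have h1 : 0 < 1 / (1 + u) ^ m := by positivity
  refine ⟨sub_nonneg.2 ((div_le_one (by positivity)).2 h0), by linarith, ?_⟩
  -- Bernoulli's inequality for 1/(1 + u) = 1 - u/(1 + u).
  have hb := one_add_mul_le_pow (a := -(u / (1 + u))) (by
    have : u / (1 + u) ≤ 1 := (div_le_one (by positivity)).2 (by linarith)
    linarith) m
  have h2 : 1 + -(u / (1 + u)) = 1 / (1 + u) := by field_simp; ring
  rw [h2, div_pow, one_pow] at hb
  have h3 : u / (1 + u) ≤ u := div_le_self hu (by linarith)
  have h4 : (m : ℝ) * (u / (1 + u)) ≤ m * u := mul_le_mul_of_nonneg_left h3 (Nat.cast_nonneg m)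
  linarith

/-! ### Almost sure convergence of the interference and integrability of the rate. -/

section
variable {Ω : Type*} [MeasurableSpace Ω] {μ : Measure Ω} {lam : ℝ≥0}
  {Mt : ℕ} {d : ℕ → Ω → Plane} {f : ℕ → Ω → ℝ} {β pt : ℝ}

namespace IsSensingNetwork

theorem ae_norm_pos (h : IsSensingNetwork μ lam Mt 1 d f) : ∀ᵐ ω ∂μ, 0 < ‖d 0 ω‖ := by
  filter_upwards [h.ppp.ae_notMem_of_volume_eq_zero (measurableSet_singleton (0 : Plane))
    (by simp)] with ω hω
  exact norm_pos_iff.2 fun h0 => hω 0 h0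

variable [IsProbabilityMeasure μ]

theorem integral_mul_expNegSum_of_two_lt (h : IsSensingNetwork μ lam Mt 1 d f) (hlam : 0 < lam)
    (hβ : 2 < β) (hpt : 0 < pt) {z : ℝ} (hz : 0 < z) {φ : ℝ → ℝ} (hφ : Measurable φ)
    (hφ1 : ∀ x, |φ x| ≤ 1) :
    AEMeasurable (fun ω => expNegSum z (normalizedTerm β pt d f ω)) μ ∧
    ∫ ω, φ (f 0 ω) * expNegSum z (normalizedTerm β pt d f ω) ∂μ =
      (∫ ω, φ (f 0 ω) ∂μ) * laplaceInterference lam β (z * pt) :=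
  h.integral_mul_expNegSum hlam (by linarith) hpt hz
    (fun x => (integrable_one_sub_fadingFactor hβ (by positivity) x).integrableOn) hφ hφ1

/-- As ε → 0, `expNegSum ε` tends to the indicator of summability, while its mean, the Laplace
transform at ε, tends to 1. Hence summability has probability 1. -/
theorem ae_summable_normalizedTerm (h : IsSensingNetwork μ lam Mt 1 d f) (hlam : 0 < lam)
    (hβ : 2 < β) (hpt : 0 < pt) : ∀ᵐ ω ∂μ, Summable (normalizedTerm β pt d f ω) := by
  classical
  set ε : ℕ → ℝ := fun m => 1 / ((m : ℝ) + 1) with hε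
  have hε0 : ∀ m, 0 < ε m := fun m => by positivity
  have hεt : Tendsto ε atTop (𝓝 0) := tendsto_one_div_add_atTop_nhds_zero_nat
  have hm : ∀ m, AEMeasurable (fun ω => expNegSum (ε m) (normalizedTerm β pt d f ω)) μ := fun m =>
    (h.integral_mul_expNegSum_of_two_lt hlam hβ hpt (hε0 m) (φ := fun _ => 1) measurable_const
      (by simp)).1
  have hi : ∀ m, ∫ ω, expNegSum (ε m) (normalizedTerm β pt d f ω) ∂μ =
      laplaceInterference lam β (ε m * pt) := fun m => by
    have := (h.integral_mul_expNegSum_of_two_lt hlam hβ hpt (hε0 m) (φ := fun _ => 1) measurable_const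
      (by simp)).2
    simpa using this
  set s : Ω → ℝ := fun ω => if Summable (normalizedTerm β pt d f ω) then 1 else 0 with hs
  have hlim : ∀ ω, Tendsto (fun m => expNegSum (ε m) (normalizedTerm β pt d f ω)) atTop
      (𝓝 (s ω)) := by
    intro ω
    simp only [hs, expNegSum]
    split_ifs with hsum
    · have := (Real.continuous_exp.tendsto _).comp
        ((hεt.mul_const (∑' k, normalizedTerm β pt d f ω k)).neg)
      simpa [Function.comp_def] using this
    · exact tendsto_const_nhds
  have hsm : AEMeasurable s μ := aemeasurable_of_tendsto_metrizable_ae' hm (ae_of_all _ hlim)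
  have hs1 : ∫ ω, s ω ∂μ = 1 := by
    refine tendsto_nhds_unique (tendsto_integral_of_dominated_convergence (fun _ => 1)
      (fun m => (hm m).aestronglyMeasurable) (integrable_const _) (fun m => ?_)
      (ae_of_all _ hlim)) ?_
    · filter_upwards [h.ae_fading_pos] with ω hω
      have hnn : 0 ≤ ∑' k, normalizedTerm β pt d f ω k := tsum_nonneg fun k => by
        have := hω (1 + k)
        unfold normalizedTerm interferenceTerm
        positivity
      simp only [expNegSum]
      split_ifs with hsum
      · rw [Real.norm_of_nonneg (Real.exp_pos _).le]
        exact Real.exp_le_one_iff.2 (neg_nonpos.2 (mul_nonneg (hε0 m).le hnn))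
      · simp
    · simp_rw [hi]
      refine tendsto_laplaceInterference (NNReal.coe_pos.2 hlam) hβ
        (fun m => mul_pos (hε0 m) hpt) ?_
      simpa using hεt.mul_const pt
  have hsb : ∀ ω, 0 ≤ 1 - s ω ∧ 1 - s ω ≤ 1 := by
    intro ω
    simp only [hs]
    split_ifs <;> simp
  have hsi : Integrable (fun ω => 1 - s ω) μ :=
    Integrable.of_bound (aemeasurable_const.sub hsm).aestronglyMeasurable 1
      (ae_of_all _ fun ω => by rw [Real.norm_of_nonneg (hsb ω).1]; exact (hsb ω).2)
  have hzero : ∫ ω, (1 - s ω) ∂μ = 0 := by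
    have hs' : Integrable s μ := Integrable.of_bound hsm.aestronglyMeasurable 1
      (ae_of_all _ fun ω => by
        rw [Real.norm_of_nonneg (by linarith [(hsb ω).2])]
        linarith [(hsb ω).1])
    rw [integral_sub (integrable_const _) hs', hs1]
    simp
  have hae := (integral_eq_zero_iff_of_nonneg (fun ω => (hsb ω).1) hsi).1 hzero
  filter_upwards [hae] with ω hω
  by_contra hn
  simp [hs, hn] at hω

end IsSensingNetwork

/-- Near 0 the factor 1 - (1 + zA)^{-m} ≤ mAz cancels 1/z; at infinity the decay of the Laplace
transform gives a multiple of z^{-1-1/β}. -/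
theorem integrableOn_rate_bound {A : ℝ} (hA : 0 ≤ A) (hlam : 0 < lam) (hβ : 2 < β) (hpt : 0 < pt)
    (m : ℕ)
    (hmeas : AEMeasurable (fun z => laplaceInterference lam β (z * pt))
      (volume.restrict (Ioi 0))) :
    IntegrableOn (fun z => 1 / z * (1 - 1 / (1 + z * A) ^ m) *
      laplaceInterference lam β (z * pt)) (Ioi 0) := by
  have hlam' : 0 < (lam : ℝ) := NNReal.coe_pos.2 hlam
  have hβ0 : 0 < β := by linarith
  obtain ⟨C, hC⟩ := exists_laplaceInterference_le (β := β) hlam' hβ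
  have hm : AEMeasurable (fun z => 1 / z * (1 - 1 / (1 + z * A) ^ m) *
      laplaceInterference lam β (z * pt)) (volume.restrict (Ioi 0)) :=
    AEMeasurable.mul (Measurable.aemeasurable (by fun_prop)) hmeas
  have hnn : ∀ z, 0 < z → 0 ≤ 1 / z * (1 - 1 / (1 + z * A) ^ m) *
      laplaceInterference lam β (z * pt) := fun z hz =>
    mul_nonneg (mul_nonneg (by positivity)
      (one_sub_one_div_pow_mem (mul_nonneg hz.le hA) m).1) (laplaceInterference_nonneg hlam')
  rw [← Ioc_union_Ioi_eq_Ioi zero_le_one] at hm ⊢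
  refine IntegrableOn.union ?_ ?_
  · refine Integrable.of_bound (hm.mono_set subset_union_left).aestronglyMeasurable (m * A) ?_
    filter_upwards [ae_restrict_mem measurableSet_Ioc] with z hz
    have hz0 : 0 < z := hz.1
    obtain ⟨h1, -, h3⟩ := one_sub_one_div_pow_mem (mul_nonneg hz0.le hA) m
    rw [Real.norm_of_nonneg (hnn z hz0)]
    have h4 : 1 / z * (1 - 1 / (1 + z * A) ^ m) ≤ m * A := by
      rw [one_div, inv_mul_le_iff₀ hz0]
      linarith
    exact (mul_le_of_le_one_right (mul_nonneg (by positivity) h1)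
      (laplaceInterference_le_one hlam' (by positivity))).trans h4
  · refine ((integrableOn_Ioi_rpow_of_lt (a := -1 - 1 / β)
      (by have : 0 < 1 / β := by positivity
          linarith) one_pos).const_mul (C * pt ^ (-(1 / β)))).mono'
      (hm.mono_set subset_union_right).aestronglyMeasurable ?_
    filter_upwards [ae_restrict_mem measurableSet_Ioi] with z hz
    have hz0 : 0 < z := one_pos.trans hz
    obtain ⟨h1, h2, -⟩ := one_sub_one_div_pow_mem (mul_nonneg hz0.le hA) m
    rw [Real.norm_of_nonneg (hnn z hz0)]
    have h5 := hC (z * pt) (by positivity)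
    rw [Real.mul_rpow hz0.le hpt.le] at h5
    have h6 : z ^ (-1 - 1 / β) = 1 / z * z ^ (-(1 / β)) := by
      rw [sub_eq_add_neg, Real.rpow_add hz0, Real.rpow_neg_one,
        inv_eq_one_div]
    calc _ ≤ 1 / z * 1 * (C * (z ^ (-(1 / β)) * pt ^ (-(1 / β)))) :=
          mul_le_mul (mul_le_mul_of_nonneg_left h2 (by positivity)) h5
            (laplaceInterference_nonneg hlam') (by positivity)
      _ = _ := by rw [h6]; ring

end

end CoopSensing

/-! ### Assembly of the rate formula. -/

/-- Radar information rate of non-cooperative sensing (`N = 1`), with the interference hole. The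
first five conclusions say that all the quantities in the last one are well defined. -/
theorem proposition2 {Ω : Type*} [MeasurableSpace Ω] (μ : Measure Ω) [IsProbabilityMeasure μ]
    (lam : ℝ≥0) (hlam : 0 < lam) (β : ℝ) (hβ : 2 < β) (σ : ℝ) (hσ : σ ≠ 0)
    (ps pt : ℝ) (hps : 0 < ps) (hpt : 0 < pt)
    (Mt Mr : ℕ) (hMt : 2 ≤ Mt) (hMr : 1 ≤ Mr)
    (d : ℕ → Ω → CoopSensing.Plane) (f : ℕ → Ω → ℝ)
    (hnet : CoopSensing.IsSensingNetwork μ lam Mt 1 d f) :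
    (∀ᵐ ω ∂μ, Summable (fun k => CoopSensing.interferenceTerm β pt 1 d f k ω)) ∧
    (∀ᵐ ω ∂μ, 0 < CoopSensing.interference β pt 1 d f ω) ∧
    Integrable (fun ω => Real.log (1 + CoopSensing.sensingSIR β σ ps pt Mr 1 d f ω)) μ ∧
    (∀ z : ℝ, 0 < z →
      IntegrableOn (fun r => CoopSensing.distanceIntegrand lam β pt z r) (Ioi 0)) ∧
    IntegrableOn (fun z => CoopSensing.rateIntegrand lam β σ ps pt Mt Mr z) (Ioi 0) ∧
    CoopSensing.radarInformationRate μ β σ ps pt Mr 1 d f =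
      ∫ z in Ioi (0 : ℝ),
        1 / z * (1 - 1 / (1 + z * σ ^ 2 * Mr * ps) ^ (Mt - 1)) *
          ∫ r in Ioi (0 : ℝ),
            2 * Real.pi * lam * r * Real.exp (-(Real.pi * lam * r ^ 2)) *
              (Real.exp (-(Real.pi * lam * r ^ 4 * (2 / β) * (z * pt) ^ (2 / β) *
                  CoopSensing.betaFn (2 / β) (1 - 2 / β))) *
                Real.exp (lam * r ^ 2 * ∫ t in (0 : ℝ)..2,
                  2 * Real.arccos (t / 2) *
                    (z * pt * r ^ β * t ^ (-β) / (1 + z * pt * r ^ β * t ^ (-β))) * t)) := by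
  open CoopSensing Filter Topology in
  have hlam' : 0 < (lam : ℝ) := NNReal.coe_pos.2 hlam
  have hMr' : 0 < (Mr : ℝ) := Nat.cast_pos.2 hMr
  have hMt1 : ((Mt : ℝ) - 1) = ((Mt - 1 : ℕ) : ℝ) := by
    rw [Nat.cast_sub (by omega), Nat.cast_one]
  set A : ℝ := σ ^ 2 * Mr * ps with hA
  have hA0 : 0 < A := by positivity
  set Y : Ω → ℝ := fun ω => ∑' k, normalizedTerm β pt d f ω k with hYdef
  have hnorm := hnet.ae_summable_normalizedTerm hlam hβ hpt
  have hterm0 : ∀ᵐ ω ∂μ, ∀ k, 0 ≤ normalizedTerm β pt d f ω k := by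
    filter_upwards [hnet.ae_fading_pos] with ω hω k
    have := hω (1 + k)
    unfold normalizedTerm interferenceTerm
    positivity
  have hsum : ∀ᵐ ω ∂μ, Summable fun k => interferenceTerm β pt 1 d f k ω := by
    filter_upwards [hnorm, hnet.ae_norm_pos] with ω h1 h2
    exact (summable_mul_left_iff (Real.rpow_pos_of_pos h2 (2 * β)).ne').1 h1
  have hpos : ∀ᵐ ω ∂μ, 0 < interference β pt 1 d f ω := by
    filter_upwards [hsum, hnet.ae_fading_pos,
      hnet.ppp.ae_norm_zero_lt_norm_one hlam hnet.sorted] with ω h1 h2 h3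
    refine h1.tsum_pos (fun k => ?_) 0 ?_
    · have := h2 (1 + k)
      unfold interferenceTerm
      positivity
    · have h4 := h2 1
      -- One positive term suffices. The two stations must be distinct, because 0 ^ (-β) is 0 by
      -- convention and the term would vanish.
      have h5 : 0 < ‖d 0 ω - d 1 ω‖ :=
        norm_pos_iff.2 (sub_ne_zero.2 fun h => by simp [h] at h3)
      unfold interferenceTerm
      simp only [add_zero]
      positivity
  have hYeq : ∀ ω, Y ω = ‖d 0 ω‖ ^ (2 * β) * interference β pt 1 d f ω := fun ω =>
    tsum_mul_left
  have hYpos : ∀ᵐ ω ∂μ, 0 < Y ω := by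
    filter_upwards [hpos, hnet.ae_norm_pos] with ω h1 h2
    rw [hYeq]
    positivity
  have hYm : AEMeasurable Y μ := by
    refine aemeasurable_of_tendsto_metrizable_ae atTop
      (f := fun n ω => ∑ k ∈ Finset.range n, normalizedTerm β pt d f ω k) (fun n => ?_) ?_
    · refine (Finset.measurable_fun_sum _ fun k _ => ?_).aemeasurable
      have h0 := hnet.ppp.measurable_point 0
      have h1 := hnet.ppp.measurable_point (1 + k)
      have h2 := hnet.measurable_fading (1 + k)
      unfold normalizedTerm interferenceTerm
      fun_prop
    · filter_upwards [hnorm] with ω hω using hω.hasSum.tendsto_sum_nat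
  -- The absolute value makes the signal nonnegative for every ω; the fading is positive only almost
  -- surely.
  set X : Ω → ℝ := fun ω => A * |f 0 ω| with hXdef
  have hXm : Measurable X := (hnet.measurable_fading 0).abs.const_mul A
  have hX0 : ∀ ω, 0 ≤ X ω := fun ω => by positivity
  have hexpY : ∀ z, (fun ω => expNegSum z (normalizedTerm β pt d f ω)) =ᵐ[μ]
      fun ω => Real.exp (-(z * Y ω)) := by
    intro z
    filter_upwards [hnorm] with ω hω
    rw [expNegSum, if_pos hω]
  have hlap : ∀ z, 0 < z → ∫ ω, Real.exp (-(z * Y ω)) ∂μ =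
      laplaceInterference lam β (z * pt) := by
    intro z hz
    have := (hnet.integral_mul_expNegSum_of_two_lt hlam hβ hpt hz (φ := fun _ => 1) measurable_const
      (by simp)).2
    rw [← integral_congr_ae (hexpY z)]
    simpa using this
  have hf0 : ∀ z, 0 < z → ∫ ω, (1 - Real.exp (-(z * A * |f 0 ω|))) ∂μ =
      1 - 1 / (1 + z * A) ^ (Mt - 1) := by
    intro z hz
    have hexp : ∫ ω, Real.exp (-(z * A * |f 0 ω|)) ∂μ = 1 / (1 + z * A) ^ (Mt - 1) := by
      rw [← integral_map (f := fun x => Real.exp (-(z * A * |x|)))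
        (hnet.measurable_fading 0).aemeasurable (by fun_prop), hnet.law_sensing 0 one_pos,
        integral_exp_neg_mul_abs_gammaMeasure _ (by positivity), hMt1, Real.rpow_natCast]
      have : (2 : ℝ) ≤ Mt := by exact_mod_cast hMt
      linarith
    rw [integral_sub (integrable_const _), hexp]
    · simp
    · have := hnet.measurable_fading 0
      refine Integrable.of_bound (Measurable.aestronglyMeasurable (by fun_prop)) 1
        (ae_of_all _ fun ω => ?_)
      rw [Real.norm_of_nonneg (Real.exp_pos _).le]
      exact Real.exp_le_one_iff.2 (neg_nonpos.2 (by positivity))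
  have hD : ∀ z, 0 < z →
      1 / z * ∫ ω, (1 - Real.exp (-(z * X ω))) * Real.exp (-(z * Y ω)) ∂μ =
        1 / z * (1 - 1 / (1 + z * A) ^ (Mt - 1)) * laplaceInterference lam β (z * pt) := by
    intro z hz
    have hφ1 : ∀ x : ℝ, |1 - Real.exp (-(z * A * |x|))| ≤ 1 := fun x => by
      obtain ⟨h1, h2, -⟩ := one_sub_exp_neg_mem_Icc (u := z * A * |x|) (by positivity)
      rwa [abs_of_nonneg h1]
    have := (hnet.integral_mul_expNegSum_of_two_lt hlam hβ hpt hz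
      (φ := fun x => 1 - Real.exp (-(z * A * |x|))) (by fun_prop) hφ1).2
    rw [hf0 z hz] at this
    rw [mul_assoc, ← this]
    congr 1
    refine integral_congr_ae ?_
    filter_upwards [hexpY z] with ω hω
    rw [hω, hXdef, mul_assoc]
  have hmeas : AEMeasurable (fun z => laplaceInterference lam β (z * pt))
      (volume.restrict (Ioi 0)) := by
    -- Measurability in z comes from monotonicity: as the mean of e^{-zY} with Y > 0, the transform
    -- decreases in z.
    refine aemeasurable_restrict_of_antitoneOn measurableSet_Ioi fun z hz w hw hzw => ?_
    have hint : ∀ z, 0 < z → Integrable (fun ω => Real.exp (-(z * Y ω))) μ := by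
      intro z hz
      refine Integrable.of_bound (AEMeasurable.aestronglyMeasurable (by fun_prop)) 1 ?_
      filter_upwards [hYpos] with ω hω
      rw [Real.norm_of_nonneg (Real.exp_pos _).le]
      exact Real.exp_le_one_iff.2 (neg_nonpos.2 (by positivity))
    rw [← hlap z hz, ← hlap w hw]
    refine integral_mono_ae (hint w hw) (hint z hz) ?_
    filter_upwards [hYpos] with ω hω
    exact Real.exp_le_exp.2 (neg_le_neg (mul_le_mul_of_nonneg_right hzw hω.le))
  have hDi := integrableOn_rate_bound hA0.le hlam hβ hpt (Mt - 1) hmeas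
  obtain ⟨hlogi, hlog⟩ := integrable_log_one_add_div hXm hX0 hYm hYpos hD hDi
  have hSIR : (fun ω => Real.log (1 + X ω / Y ω)) =ᵐ[μ]
      fun ω => Real.log (1 + sensingSIR β σ ps pt Mr 1 d f ω) := by
    filter_upwards [hnet.ae_fading_pos, hnet.ae_norm_pos, hpos] with ω h1 h2 h3
    congr 2
    have hr : 0 < ‖d 0 ω‖ ^ β := Real.rpow_pos_of_pos h2 _
    rw [hYeq, sensingSIR, Finset.sum_range_one, Real.rpow_neg h2.le, two_mul,
      Real.rpow_add h2]
    simp only [hXdef, hA, abs_of_pos (h1 0)]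
    field_simp
  have hdist := fun z (hz : 0 < z) => integrableOn_distanceIntegrand (pt := pt) hlam' hβ
    (mul_pos hz hpt)
  have hrate : EqOn (fun z => 1 / z * (1 - 1 / (1 + z * A) ^ (Mt - 1)) *
      laplaceInterference lam β (z * pt))
      (fun z => rateIntegrand lam β σ ps pt Mt Mr z) (Ioi 0) := by
    intro z hz
    simp only [rateIntegrand, ← (hdist z hz).2, hA]
    rw [show z * (σ ^ 2 * Mr * ps) = z * σ ^ 2 * Mr * ps by ring]
  refine ⟨hsum, hpos, hlogi.congr hSIR, fun z hz => (hdist z hz).1,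
    hDi.congr_fun hrate measurableSet_Ioi, ?_⟩
  rw [radarInformationRate, ← integral_congr_ae hSIR, hlog,
    setIntegral_congr_fun measurableSet_Ioi hrate]
  rfl
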